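/- Let $S_3=\langle d_1,d_2,d_3\rangle$ be a numerical semigroup with $\gcd(d_1,d_2,d_3)=1$, $3\le d_1<d_2<d_3\le d_1d_2-d_1-d_2$, none of the $d_i$ being a nonnegative integer combination of the other two. Let $\Delta_3=\mathbb Z_{>0}\setminus S_3$ be its set of gaps, $F_3=\max\Delta_3$, $g_3=F_3+d_1+d_2+d_3$, $\pi_3=d_1d_2d_3$, $G_k=\sum_{s\in\Delta_3}s^k$. Put $$K_r=\sum_{k=0}^{r}\binom rk T_{r-k}\,G_k+\frac{T'_{r+1}}{r+1},\qquad \sum_{n\ge0}T_n\frac{t^n}{n!}=\prod_{i=1}^3\frac{e^{d_it}-1}{d_it},\qquad \sum_{n\ge0}T'_n\frac{t^n}{n!}=\frac{t}{e^t-1}\prod_{i=1}^3\frac{e^{d_it}-1}{d_it},$$ (so $K_0=G_0+\tfrac12(d_1+d_2+d_3-1)$), and let $h_r=K_r/g_3^{\,r+1}$ be the rescaled genera and $v=\pi_3/g_3^2$. Syzygy degrees of $S_3$ are integers $0\le x_1,x_2,x_3,y<g_3$ with $$\sum_{s\in S_3}t^s=\frac{1-t^{x_1}-t^{x_2}-t^{x_3}+t^{y}+t^{g_3}}{(1-t^{d_1})(1-t^{d_2})(1-t^{d_3})},$$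 where a cancelling pair $x_j=y$, if there is one, is recorded with degree $0$; put $u=(y+g_3)/g_3$. $S_3$ is symmetric if $F_3-s\notin\Delta_3$ for every $s\in\Delta_3$. (1) If $S_3$ is symmetric, then $h_0=\frac12$, syzygy degrees exist and always $u=1$, $0<v\le\frac14$, and $$h_1=\tfrac16\left(1-\tfrac12v\right),\quad h_2=\tfrac1{12}(1-v),\quad h_3=\tfrac1{20}\left(1-\tfrac32v+\tfrac13v^2\right),\quad h_4=\tfrac1{30}\left(1-2v+v^2\right),$$ $$h_5=\tfrac1{42}\left(1-\tfrac52v+2v^2-\tfrac14v^3\right),\quad h_6=\tfrac1{56}\left(1-3v+\tfrac{10}3v^2-v^3\right).$$ Hence $$\tfrac7{48}\le h_1<\tfrac16,\quad \tfrac1{16}\le h_2<\tfrac1{12},\quad \tfrac{31}{960}\le h_3<\tfrac1{20},\quad \tfrac3{160}\le h_4<\tfrac1{30},\quad \tfrac{127}{10752}\le h_5<\tfrac1{42},\quad \tfrac{85}{10752}\le h_6<\tfrac1{56},$$ and all the lower bounds are strict as well if $v<\frac14$. (2) These intervals are sharp: for each $1\le r\le 6$ the lower bound is the minimum, and the upper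 bound is the supremum, of $h_r$ over all symmetric $S_3$ as above. (3) If $S_3$ is not symmetric, then $\frac12\le h_0<\frac59$, $\frac5{36}<h_1<\frac{11}{54}$, $\frac1{18}<h_2<\frac19$, $0.02443<h_3<0.07515$. These ranges contain the ranges in the symmetric case: $h_0$ takes exactly the value $\frac12\in[\frac12,\frac59)$ on symmetric $S_3$, and $$\left[\tfrac7{48},\tfrac16\right]\subset\left(\tfrac5{36},\tfrac{11}{54}\right),\qquad \left[\tfrac1{16},\tfrac1{12}\right]\subset\left(\tfrac1{18},\tfrac19\right),\qquad \left[\tfrac{31}{960},\tfrac1{20}\right]\subset(0.02443,\,0.07515).$$ -/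

import Mathlib

namespace NS3

/-- The set of generators `d₁, d₂, d₃` satisfies `gcd(d₁,d₂,d₃) = 1`,
`3 ≤ d₁ < d₂ < d₃ ≤ d₁ d₂ - d₁ - d₂`, and none of the generators is linearly
representable by the others with nonnegative integer coefficients. -/
structure Admissible (d : Fin 3 → ℕ) : Prop where
  gcd_eq_one : Nat.gcd (Nat.gcd (d 0) (d 1)) (d 2) = 1
  three_le : 3 ≤ d 0
  lt01 : d 0 < d 1
  lt12 : d 1 < d 2
  le_bound : d 2 + d 0 + d 1 ≤ d 0 * d 1
  minimal : ∀ i, d i ∉ AddSubmonoid.closure (d '' {i}ᶜ)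

/-- The numerical semigroup `⟨d₁, d₂, d₃⟩` (it contains `0`). -/
def semigroup (d : Fin 3 → ℕ) : AddSubmonoid ℕ := AddSubmonoid.closure (Set.range d)

/-- The set of gaps. -/
def gaps (d : Fin 3 → ℕ) : Set ℕ := {s | s ∉ semigroup d}

/-- The Frobenius number: the largest gap (see `frobeniusNumber_frob`). -/
noncomputable def frob (d : Fin 3 → ℕ) : ℕ := sSup (gaps d)

theorem frobeniusNumber_frob {d : Fin 3 → ℕ} (hd : Admissible d) :
    FrobeniusNumber (frob d) (Set.range d) := by
  have h1 : ∃ n, FrobeniusNumber n (Set.range d) := by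
    rw [exists_frobeniusNumber_iff]
    constructor
    · have h : ∀ i, Nat.setGcd (Set.range d) ∣ d i := fun i =>
        Nat.setGcd_dvd_of_mem (Set.mem_range_self i)
      have h2 := Nat.dvd_gcd (Nat.dvd_gcd (h 0) (h 1)) (h 2)
      rw [hd.gcd_eq_one] at h2
      exact Nat.dvd_one.mp h2
    · rintro ⟨i, hi⟩
      have h3 := hd.three_le
      have h4 := hd.lt01
      have h5 := hd.lt12
      fin_cases i <;> simp at hi <;> omega
  obtain ⟨n, hn⟩ := h1
  have h2 : frob d = n := IsGreatest.csSup_eq hn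
  rw [h2]
  exact hn

theorem gaps_finite {d : Fin 3 → ℕ} (hd : Admissible d) : (gaps d).Finite :=
  (Set.finite_Iic (frob d)).subset fun _ hs => (frobeniusNumber_frob hd).2 hs

/-- The semigroup is symmetric: for every gap `s`, the number `F - s` is not a gap.
(The subtraction is a true one, since every gap is at most `F`.) -/
def IsSymmetric (d : Fin 3 → ℕ) : Prop := ∀ s ∈ gaps d, frob d - s ∉ gaps d

/-- `g₃ = F₃ + d₁ + d₂ + d₃`. -/
noncomputable def g (d : Fin 3 → ℕ) : ℕ := frob d + ∑ i, d i

/-- `π₃ = d₁ d₂ d₃`. -/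
def prodGen (d : Fin 3 → ℕ) : ℕ := ∏ i, d i

open Classical in
/-- The Hilbert series `∑_{s ∈ S} t^s`. -/
noncomputable def hilbert (d : Fin 3 → ℕ) : PowerSeries ℤ :=
  PowerSeries.mk fun n => if n ∈ semigroup d then 1 else 0

/-- `x₁, x₂, x₃` and `y, g₃` are the degrees of the syzygies: the Hilbert series equals
`(1 - t^x₁ - t^x₂ - t^x₃ + t^y + t^g₃) / ((1-t^d₁)(1-t^d₂)(1-t^d₃))` with `0 ≤ x_j, y < g₃`.
A pair `x_j = y` of cancelling terms carries no information; if the numerator has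
such a pair, its degree is recorded as `0`. -/
structure IsSyzygyDegrees (d : Fin 3 → ℕ) (x : Fin 3 → ℕ) (y : ℕ) : Prop where
  rep : hilbert d * ∏ i, (1 - (PowerSeries.X : PowerSeries ℤ) ^ d i) =
    1 - ∑ j, PowerSeries.X ^ x j + PowerSeries.X ^ y + PowerSeries.X ^ g d
  x_lt : ∀ j, x j < g d
  y_lt : y < g d
  cancel : ∀ j, x j = y → y = 0

/-- The ratio `u = Y₁ / g₃ = (y + g₃) / g₃`. -/
noncomputable def u (d : Fin 3 → ℕ) (y : ℕ) : ℝ := ((y : ℝ) + g d) / g d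

/-- The ratio `v = π₃ / g₃²`. -/
noncomputable def v (d : Fin 3 → ℕ) : ℝ := (prodGen d : ℝ) / (g d : ℝ) ^ 2

/-- The genera `G_k = ∑_{s gap} s^k`; in particular `G_0` is the number of gaps. -/
noncomputable def genus (d : Fin 3 → ℕ) (k : ℕ) : ℝ := ∑ᶠ s ∈ gaps d, (s : ℝ) ^ k

/-- The exponential generating function `∏_i (exp(d_i t) - 1) / (d_i t) = ∑_n T_n(σ) t^n / n!`
of the symmetric polynomials `T_n` in `d₁, d₂, d₃` (as polynomials in the power sums `σ_k`). -/
noncomputable def toddSeries (d : Fin 3 → ℕ) : PowerSeries ℝ :=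
  ∏ i, PowerSeries.mk fun n => (d i : ℝ) ^ n / ((n + 1).factorial : ℝ)

/-- `T_n(σ)`, where `σ_k = d₁^k + d₂^k + d₃^k`. -/
noncomputable def T (d : Fin 3 → ℕ) (n : ℕ) : ℝ :=
  (n.factorial : ℝ) * PowerSeries.coeff n (toddSeries d)

/-- `2^n T_n(δ)`, where `δ_k = (σ_k - 1) / 2^k`; the generating function of these numbers is
`∏_i (exp(d_i t) - 1) / (d_i t) · t / (exp t - 1)`. -/
noncomputable def Tdelta (d : Fin 3 → ℕ) (n : ℕ) : ℝ :=
  (n.factorial : ℝ) * PowerSeries.coeff n (toddSeries d * bernoulliPowerSeries ℝ)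

/-- The linear combinations of genera
`K_r = ∑_{k=0}^r binom(r,k) T_{r-k}(σ) G_k + 2^{r+1}/(r+1) T_{r+1}(δ)`. The cases `r = 0, 1, 2`
are written out in `K_zero`, `K_one`, `K_two`. -/
noncomputable def K (d : Fin 3 → ℕ) (r : ℕ) : ℝ :=
  ∑ k ∈ Finset.range (r + 1), (r.choose k : ℝ) * T d (r - k) * genus d k
    + Tdelta d (r + 1) / (r + 1)

/-- The rescaled genera `h_r = K_r / g₃^{r+1}`. -/
noncomputable def h (d : Fin 3 → ℕ) (r : ℕ) : ℝ := K d r / (g d : ℝ) ^ (r + 1)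

/-- The power sums `σ_k = d₁^k + d₂^k + d₃^k`. -/
noncomputable def σ (d : Fin 3 → ℕ) (k : ℕ) : ℝ := ∑ i, (d i : ℝ) ^ k

/-- `δ_k = (σ_k - 1) / 2^k`. -/
noncomputable def δ (d : Fin 3 → ℕ) (k : ℕ) : ℝ := (σ d k - 1) / 2 ^ k

theorem K_zero (d : Fin 3 → ℕ) : K d 0 = genus d 0 + δ d 1 := by
  simp [K, T, Tdelta, toddSeries, bernoulliPowerSeries, PowerSeries.coeff_mul, δ, σ,
    Fin.prod_univ_three, Fin.sum_univ_three, Finset.Nat.antidiagonal_succ, Nat.factorial,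
    bernoulli_one]
  ring

theorem K_one (d : Fin 3 → ℕ) :
    K d 1 = genus d 1 + σ d 1 / 2 * genus d 0 + (3 * δ d 1 ^ 2 + δ d 2) / 6 := by
  simp [K, T, Tdelta, toddSeries, bernoulliPowerSeries, PowerSeries.coeff_mul, δ, σ,
    Fin.prod_univ_three, Fin.sum_univ_three, Finset.Nat.antidiagonal_succ, Nat.factorial,
    bernoulli_one, bernoulli_two, Finset.sum_range_succ]
  ring

theorem K_two (d : Fin 3 → ℕ) :
    K d 2 = genus d 2 + σ d 1 * genus d 1 + (3 * σ d 1 ^ 2 + σ d 2) / 12 * genus d 0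
      + δ d 1 * (δ d 1 ^ 2 + δ d 2) / 3 := by
  have h3 : bernoulli 3 = 0 := bernoulli_eq_zero_of_odd (by decide) (by norm_num)
  simp [K, T, Tdelta, toddSeries, bernoulliPowerSeries, PowerSeries.coeff_mul, δ, σ,
    Fin.prod_univ_three, Fin.sum_univ_three, Finset.Nat.antidiagonal_succ, Nat.factorial,
    bernoulli_one, bernoulli_two, h3,
    Finset.sum_range_succ]
  ring

/-- The values that `h_r` takes on symmetric semigroups. -/
def symValues (r : ℕ) : Set ℝ := {t | ∃ d, Admissible d ∧ IsSymmetric d ∧ h d r = t}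

/-- The values that `h_r` takes on non-symmetric semigroups. -/
def nonsymValues (r : ℕ) : Set ℝ := {t | ∃ d, Admissible d ∧ ¬ IsSymmetric d ∧ h d r = t}

end NS3

open NS3

namespace NS3

/-! Let `P` be the Hilbert series multiplied by `∏ (1 - t^dᵢ)`. Substituting `t = e^z` turns `P`
into `π₃ z²` times a series whose coefficient of `z^(r+1)` is `K_r / r!` (`K_div_factorial`). Hence
`K_r` is a signed sum of `(r+3)`-rd powers of the exponents of `P`, divided by `(r+1)(r+2)(r+3) π₃`.
The coefficients of `z` and `z²` give two relations between the exponents.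

The shape of `P` comes from the Apéry set of `d 2`. It is indexed by a rectangle or an L-shaped
region of lattice points (`reduced_shape`), so `P` is either `(1 - t^a)(1 - t^b)` or has six terms
with every `x` below both `y` (`numerator_cases`).

In the product case put `α = a / g₃`. Then `v = α(1 - α)` and `h_r` depends on `v` alone. In the
six-term case `h₀, …, h₃` are polynomials in `v`, `w = y / g₃` and a third parameter `q`, with `h₀ =
(1 + q)/2`, `0 < q < 1/9` and `v < 1/3` (`h_of_six_terms_reduced`); these ranges give the
non-symmetric bounds. Counting gaps shows that symmetry means `h₀ = 1/2` (`isSymmetric_iff`), so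
symmetric semigroups are exactly those of the product case.

For sharpness, `⟨6, 10, 15⟩` has `v = 1/4`, and the symmetric semigroups `⟨2k, 2k+1, 2k+2⟩` have `v
→ 0`. -/

theorem mem_semigroup_iff {d : Fin 3 → ℕ} {n : ℕ} :
    n ∈ semigroup d ↔ ∃ a b c, a * d 0 + b * d 1 + c * d 2 = n := by
  constructor
  · intro hn
    induction hn using AddSubmonoid.closure_induction with
    | mem x hx =>
      obtain ⟨i, rfl⟩ := hx
      fin_cases i
      · exact ⟨1, 0, 0, by simp⟩
      · exact ⟨0, 1, 0, by simp⟩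
      · exact ⟨0, 0, 1, by simp⟩
    | zero => exact ⟨0, 0, 0, by simp⟩
    | add x y _ _ hx hy =>
      obtain ⟨a, b, c, rfl⟩ := hx
      obtain ⟨a', b', c', rfl⟩ := hy
      exact ⟨a + a', b + b', c + c', by ring⟩
  · rintro ⟨a, b, c, rfl⟩
    have hm : ∀ i, d i ∈ semigroup d := fun i =>
      AddSubmonoid.subset_closure (Set.mem_range_self i)
    have hs : ∀ (m : ℕ) i, m * d i ∈ semigroup d := fun m i => by
      simpa using AddSubmonoid.nsmul_mem _ (hm i) m
    exact add_mem (add_mem (hs a 0) (hs b 1)) (hs c 2)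

/-! ### The gap polynomial and the numerator of the Hilbert series. -/

/-- The generating polynomial of the gaps. -/
noncomputable def gapPoly (d : Fin 3 → ℕ) : Polynomial ℤ := ∑ᶠ s ∈ gaps d, Polynomial.X ^ s

theorem gapPoly_eq {d : Fin 3 → ℕ} (hd : Admissible d) :
    gapPoly d = ∑ s ∈ (gaps_finite hd).toFinset, Polynomial.X ^ s :=
  finsum_mem_eq_finite_toFinset_sum _ _

theorem genus_eq {d : Fin 3 → ℕ} (hd : Admissible d) (k : ℕ) :
    genus d k = ∑ s ∈ (gaps_finite hd).toFinset, (s : ℝ) ^ k :=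
  finsum_mem_eq_finite_toFinset_sum _ _

open Classical in
theorem coeff_gapPoly {d : Fin 3 → ℕ} (hd : Admissible d) (n : ℕ) :
    (gapPoly d).coeff n = if n ∈ gaps d then 1 else 0 := by
  rw [gapPoly_eq hd, Polynomial.finsetSum_coeff]
  simp [Polynomial.coeff_X_pow]

theorem hilbert_add_gapPoly {d : Fin 3 → ℕ} (hd : Admissible d) :
    hilbert d + (gapPoly d : PowerSeries ℤ) = PowerSeries.mk 1 := by
  ext n
  rw [map_add, Polynomial.coeff_coe, coeff_gapPoly hd, hilbert, PowerSeries.coeff_mk,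
    PowerSeries.coeff_mk]
  by_cases hn : n ∈ semigroup d <;> simp [gaps, hn]

theorem pos {d : Fin 3 → ℕ} (hd : Admissible d) (i : Fin 3) : 0 < d i := by
  have h1 := hd.three_le
  have h2 := hd.lt01
  have h3 := hd.lt12
  fin_cases i <;> simp <;> omega

-- The Hilbert series is `1/(1 - X)` minus the gap polynomial. The signs agree because the number of
-- generators is odd.
open Polynomial in
theorem numerator_identity {d : Fin 3 → ℕ} (hd : Admissible d) {P : ℤ[X]}
    (hP : hilbert d * ∏ i, (1 - (PowerSeries.X : PowerSeries ℤ) ^ d i) = P) :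
    (X - 1) * P = (∏ i, (X ^ d i - 1)) * (1 + (X - 1) * gapPoly d) := by
  apply Polynomial.coe_injective
  have h1 := hilbert_add_gapPoly hd
  have h2 := PowerSeries.mk_one_mul_one_sub_eq_one ℤ
  simp only [Fin.prod_univ_three] at hP ⊢
  push_cast
  rw [← hP]
  rw [← h1] at h2
  linear_combination (1 - (PowerSeries.X : PowerSeries ℤ) ^ d 0) *
    (1 - (PowerSeries.X : PowerSeries ℤ) ^ d 1) *
    (1 - (PowerSeries.X : PowerSeries ℤ) ^ d 2) * (-h2)

theorem frob_mem_gaps {d : Fin 3 → ℕ} (hd : Admissible d) : frob d ∈ gaps d :=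
  (frobeniusNumber_frob hd).1

theorem le_frob {d : Fin 3 → ℕ} (hd : Admissible d) {s : ℕ} (hs : s ∈ gaps d) : s ≤ frob d :=
  (frobeniusNumber_frob hd).2 hs

open Polynomial in
theorem natDegree_gapPoly {d : Fin 3 → ℕ} (hd : Admissible d) :
    (gapPoly d).natDegree = frob d := by
  classical
  apply natDegree_eq_of_le_of_coeff_ne_zero
  · rw [natDegree_le_iff_coeff_eq_zero]
    intro n hn
    rw [coeff_gapPoly hd, if_neg]
    intro h
    exact absurd (le_frob hd h) (by omega)
  · rw [coeff_gapPoly hd, if_pos (frob_mem_gaps hd)]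
    exact one_ne_zero

open Polynomial in
theorem monic_gapPoly {d : Fin 3 → ℕ} (hd : Admissible d) : (gapPoly d).Monic := by
  classical
  rw [Monic.def, leadingCoeff, natDegree_gapPoly hd, coeff_gapPoly hd,
    if_pos (frob_mem_gaps hd)]

-- This identifies the top exponent of any explicit numerator with `g₃`, and its leading coefficient
-- with `1`.
open Polynomial in
theorem monic_numerator {d : Fin 3 → ℕ} (hd : Admissible d) {P : ℤ[X]}
    (hP : hilbert d * ∏ i, (1 - (PowerSeries.X : PowerSeries ℤ) ^ d i) = P) :
    P.Monic ∧ P.natDegree = g d := by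
  have h := numerator_identity hd hP
  have hX : (X - 1 : ℤ[X]).Monic := by simpa using monic_X_sub_C (1 : ℤ)
  have hXd : (X - 1 : ℤ[X]).natDegree = 1 := by simpa using natDegree_X_sub_C (1 : ℤ)
  have hmd : ((X - 1) * gapPoly d).natDegree = 1 + frob d := by
    rw [hX.natDegree_mul (monic_gapPoly hd), hXd, natDegree_gapPoly hd]
  have hm : ((X - 1) * gapPoly d).Monic := hX.mul (monic_gapPoly hd)
  have hlt : (1 : ℤ[X]).degree < ((X - 1) * gapPoly d).degree := by
    rw [degree_eq_natDegree hm.ne_zero, hmd, degree_one]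
    exact_mod_cast (by omega : 0 < 1 + frob d)
  have hm1 : (1 + (X - 1) * gapPoly d).Monic := hm.add_of_right hlt
  have hm1d : (1 + (X - 1) * gapPoly d).natDegree = 1 + frob d := by
    rw [natDegree_add_eq_right_of_degree_lt hlt, hmd]
  have hq : ∀ i ∈ Finset.univ, (X ^ d i - 1 : ℤ[X]).Monic := fun i _ => by
    simpa using monic_X_pow_sub_C (1 : ℤ) (pos hd i).ne'
  have hqd : (∏ i, (X ^ d i - 1 : ℤ[X])).natDegree = ∑ i, d i := by
    rw [natDegree_prod_of_monic _ _ hq]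
    exact Finset.sum_congr rfl fun i _ => by simpa using natDegree_X_pow_sub_C (r := (1 : ℤ))
  have hq' := monic_prod_of_monic _ _ hq
  have hPm : P.Monic := hX.of_mul_monic_left (h ▸ hq'.mul hm1)
  refine ⟨hPm, ?_⟩
  have h2 := congrArg natDegree h
  rw [hX.natDegree_mul hPm, hq'.natDegree_mul hm1, hXd, hqd, hm1d] at h2
  rw [g]
  omega

/-! ### The substitution `t = e^z`: `K_r` as a Taylor coefficient of the numerator. -/

open PowerSeries in
theorem exp_pow_sub_one (n : ℕ) : exp ℝ ^ n - 1 =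
    C (n : ℝ) * X * PowerSeries.mk fun k => (n : ℝ) ^ k / ((k + 1).factorial : ℝ) := by
  ext k
  rw [exp_pow_eq_rescale_exp, mul_assoc, coeff_C_mul]
  cases k with
  | zero => rw [map_sub, coeff_rescale, coeff_exp]; simp
  | succ k =>
    rw [coeff_succ_X_mul, map_sub, coeff_rescale, coeff_exp, coeff_mk, coeff_one,
      if_neg k.succ_ne_zero]
    simp
    ring

theorem toddSeries_mul (d : Fin 3 → ℕ) :
    ∏ i, (PowerSeries.exp ℝ ^ d i - 1) =
      PowerSeries.C (prodGen d : ℝ) * PowerSeries.X ^ 3 * toddSeries d := by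
  simp only [exp_pow_sub_one, toddSeries, prodGen, Fin.prod_univ_three, Nat.cast_mul, map_mul]
  ring

-- After the substitution, `numerator_identity` still carries a factor `e^z - 1`. Multiplying by the
-- Bernoulli series turns that factor into `z`, which cancels.
open PowerSeries in
theorem aeval_exp_numerator {d : Fin 3 → ℕ} (hd : Admissible d) {P : Polynomial ℤ}
    (hP : hilbert d * ∏ i, (1 - (PowerSeries.X : PowerSeries ℤ) ^ d i) = P) :
    Polynomial.aeval (exp ℝ) P = C (prodGen d : ℝ) *
      (X ^ 2 * (toddSeries d * bernoulliPowerSeries ℝ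
        + X * (toddSeries d * Polynomial.aeval (exp ℝ) (gapPoly d)))) := by
  have h := congrArg (Polynomial.aeval (exp ℝ)) (numerator_identity hd hP)
  simp only [map_mul, map_sub, map_add, map_one, map_prod, map_pow, Polynomial.aeval_X] at h
  rw [toddSeries_mul] at h
  have hB := bernoulliPowerSeries_mul_exp_sub_one ℝ
  apply mul_left_cancel₀ (X_ne_zero (R := ℝ))
  generalize Polynomial.aeval (exp ℝ) P = p at *
  generalize Polynomial.aeval (exp ℝ) (gapPoly d) = q at *
  generalize bernoulliPowerSeries ℝ = B at *
  generalize exp ℝ = E at *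
  linear_combination B * h + (C (prodGen d : ℝ) * X ^ 3 * toddSeries d * q - p) * hB

open PowerSeries in
theorem coeff_aeval_exp_X_pow (n k : ℕ) :
    coeff n (exp ℝ ^ k) = (k : ℝ) ^ n / n.factorial := by
  rw [exp_pow_eq_rescale_exp, coeff_rescale, coeff_exp]
  simp
  rfl

open PowerSeries in
theorem coeff_aeval_gapPoly {d : Fin 3 → ℕ} (hd : Admissible d) (n : ℕ) :
    coeff n (Polynomial.aeval (exp ℝ) (gapPoly d)) = genus d n / n.factorial := by
  rw [gapPoly_eq hd, genus_eq hd, Finset.sum_div]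
  simp only [map_sum, map_pow, Polynomial.aeval_X, coeff_aeval_exp_X_pow]

open PowerSeries in
theorem K_div_factorial {d : Fin 3 → ℕ} (hd : Admissible d) (r : ℕ) :
    coeff (r + 1) (toddSeries d * bernoulliPowerSeries ℝ
        + X * (toddSeries d * Polynomial.aeval (exp ℝ) (gapPoly d))) =
      K d r / r.factorial := by
  rw [map_add, coeff_succ_X_mul, coeff_mul _ (toddSeries d) (Polynomial.aeval _ _),
    ← Finset.Nat.sum_antidiagonal_swap, Finset.Nat.sum_antidiagonal_eq_sum_range_succ_mk, K,
    add_div, Finset.sum_div, add_comm]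
  congr 1
  · apply Finset.sum_congr rfl
    intro k hk
    have hk' : k ≤ r := Nat.lt_succ_iff.mp (Finset.mem_range.mp hk)
    simp only [Prod.swap, coeff_aeval_gapPoly hd, T, Nat.cast_choose ℝ hk']
    have h1 := Nat.factorial_ne_zero r
    have h2 := Nat.factorial_ne_zero k
    have h3 := Nat.factorial_ne_zero (r - k)
    field_simp
  · rw [Tdelta, Nat.factorial_succ]
    have h1 := Nat.factorial_ne_zero r
    push_cast
    field_simp

open PowerSeries in
theorem coeff_numerator_K {d : Fin 3 → ℕ} (hd : Admissible d) {P : Polynomial ℤ}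
    (hP : hilbert d * ∏ i, (1 - (PowerSeries.X : PowerSeries ℤ) ^ d i) = P) (r : ℕ) :
    coeff (r + 3) (Polynomial.aeval (exp ℝ) P) = prodGen d * (K d r / r.factorial) := by
  rw [aeval_exp_numerator hd hP, coeff_C_mul, show r + 3 = (r + 1) + 2 by ring,
    coeff_X_pow_mul, K_div_factorial hd]

open PowerSeries in
theorem coeff_numerator_two {d : Fin 3 → ℕ} (hd : Admissible d) {P : Polynomial ℤ}
    (hP : hilbert d * ∏ i, (1 - (PowerSeries.X : PowerSeries ℤ) ^ d i) = P) :
    coeff 2 (Polynomial.aeval (exp ℝ) P) = prodGen d := by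
  rw [aeval_exp_numerator hd hP, coeff_C_mul, show 2 = 0 + 2 by ring, coeff_X_pow_mul]
  simp [toddSeries, Fin.prod_univ_three, bernoulliPowerSeries]

open PowerSeries in
theorem coeff_numerator_one {d : Fin 3 → ℕ} (hd : Admissible d) {P : Polynomial ℤ}
    (hP : hilbert d * ∏ i, (1 - (PowerSeries.X : PowerSeries ℤ) ^ d i) = P) :
    coeff 1 (Polynomial.aeval (exp ℝ) P) = 0 := by
  rw [aeval_exp_numerator hd hP, coeff_C_mul, coeff_X_pow_mul']
  simp

/-! ### Symmetry as the condition `h₀ = 1/2`. -/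

theorem prodGen_pos {d : Fin 3 → ℕ} (hd : Admissible d) : 0 < prodGen d :=
  Finset.prod_pos fun i _ => pos hd i

theorem g_pos {d : Fin 3 → ℕ} (hd : Admissible d) : 0 < g d := by
  have := pos hd 0
  rw [g, Fin.sum_univ_three]
  omega

/-- The reflection `s ↦ F - s` injects the non-gaps up to `F` into the gaps. Symmetry says that this
is a bijection, that is, `2 G₀ = F + 1`, which is `h₀ = 1/2` after rescaling. -/
theorem isSymmetric_iff {d : Fin 3 → ℕ} (hd : Admissible d) :
    IsSymmetric d ↔ h d 0 = 1 / 2 := by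
  have hG : genus d 0 = ((gaps_finite hd).toFinset.card : ℝ) := by
    rw [genus_eq hd]
    simp
  set G := (gaps_finite hd).toFinset with hGdef
  have hmem : ∀ s, s ∈ G ↔ s ∉ semigroup d := fun s => by simp [hGdef, gaps]
  set N := (Finset.range (frob d + 1)) \ G with hN
  have hsub : G ⊆ Finset.range (frob d + 1) := fun s hs => by
    have := le_frob hd ((Set.Finite.mem_toFinset _).mp hs)
    simp
    omega
  have hcard : N.card + G.card = frob d + 1 := by
    rw [hN, Finset.card_sdiff_add_card_eq_card hsub, Finset.card_range]
  have hF : frob d ∉ semigroup d := frob_mem_gaps hd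
  have hmap : ∀ s ∈ N, frob d - s ∈ G := by
    intro s hs
    simp only [hN, Finset.mem_sdiff, Finset.mem_range, hmem, not_not] at hs
    rw [hmem]
    intro h'
    have := add_mem h' hs.2
    rw [Nat.sub_add_cancel (by omega)] at this
    exact hF this
  have hinj : Set.InjOn (fun s => frob d - s) (N : Set ℕ) := by
    intro a ha b hb hab
    simp only [hN, Finset.coe_sdiff, Set.mem_sdiff, Finset.mem_coe, Finset.mem_range] at ha hb
    simp only at hab
    omega
  have hle : N.card ≤ G.card := Finset.card_le_card_of_injOn _ hmap hinj
  have key : IsSymmetric d ↔ N.card = G.card := by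
    constructor
    · intro hs
      apply le_antisymm hle
      apply Finset.card_le_card_of_injOn (fun s => frob d - s)
      · intro s hs'
        have h1 : s ∈ gaps d := (hmem s).mp hs'
        have h2 := hs s h1
        simp only [hN, Finset.coe_sdiff, Set.mem_sdiff, Finset.mem_coe, Finset.mem_range, hmem]
        exact ⟨by omega, fun h3 => h2 h3⟩
      · intro a ha b hb hab
        have h1 := Finset.mem_range.mp (hsub ha)
        have h2 := Finset.mem_range.mp (hsub hb)
        simp only at hab
        omega
    · intro hc s hs
      have himg := Finset.eq_of_subset_of_card_le (Finset.image_subset_iff.mpr hmap)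
        (by rw [Finset.card_image_of_injOn hinj, hc])
      have hsG : s ∈ G := (hmem s).mpr hs
      rw [← himg, Finset.mem_image] at hsG
      obtain ⟨t, ht, rfl⟩ := hsG
      simp only [hN, Finset.mem_sdiff, Finset.mem_range, hmem, not_not] at ht
      rw [Nat.sub_sub_self (by omega)]
      exact fun h' => h' ht.2
  have hg : (g d : ℝ) = frob d + σ d 1 := by
    simp [g, σ]
  have hg0 : (0 : ℝ) < g d := by exact_mod_cast g_pos hd
  rw [key, h, K_zero, hG, δ, zero_add, pow_one, pow_one, div_eq_iff hg0.ne', hg]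
  constructor
  · intro hc
    have : (2 * G.card : ℝ) = frob d + 1 := by exact_mod_cast (by omega)
    linarith
  · intro hc
    have : (2 * G.card : ℝ) = frob d + 1 := by linarith
    have : 2 * G.card = frob d + 1 := by exact_mod_cast this
    omega

/-! ### Reduced exponents: a lattice model of the Apéry set of `r`. -/

/-- The exponents `(i, j)` such that `i p + j q` has no representation
`i' p + j' q + k' r` with `k' > 0`, or with `k' = 0` and `i' < i`. -/
def Reduced (p q r : ℕ) (i j : ℕ) : Prop :=
  ∀ i' j' k', i' * p + j' * q + k' * r = i * p + j * q → k' = 0 ∧ i ≤ i'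

section Reduced

variable {p q r : ℕ}

theorem Reduced.mono {i j i' j' : ℕ} (h : Reduced p q r i j) (hi : i' ≤ i) (hj : j' ≤ j) :
    Reduced p q r i' j' := by
  obtain ⟨a, rfl⟩ := Nat.exists_eq_add_of_le hi
  obtain ⟨b, rfl⟩ := Nat.exists_eq_add_of_le hj
  intro x y z he
  have := h (x + a) (y + b) z (by linear_combination he)
  omega

theorem Reduced.unique (hq : 0 < q) {i j k i' j' k' : ℕ} (h : Reduced p q r i j)
    (h' : Reduced p q r i' j') (he : i * p + j * q + k * r = i' * p + j' * q + k' * r) :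
    i = i' ∧ j = j' ∧ k = k' := by
  have hk : k = k' := by
    rcases le_total k k' with hk | hk
    · obtain ⟨c, rfl⟩ := Nat.exists_eq_add_of_le hk
      have := h i' j' c (by linear_combination -he)
      omega
    · obtain ⟨c, rfl⟩ := Nat.exists_eq_add_of_le hk
      have := h' i j c (by linear_combination he)
      omega
  subst hk
  have h1 := h i' j' 0 (by linear_combination -he)
  have h2 := h' i j 0 (by linear_combination he)
  obtain rfl : i = i' := by omega
  refine ⟨rfl, ?_, rfl⟩
  have : j * q = j' * q := by linear_combination he
  exact Nat.eq_of_mul_eq_mul_right hq this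

/-- Rewriting terminates: a step that uses `r` lowers the value `i p + j q`, and any other step
keeps the value and lowers `i`. -/
theorem exists_reduced (hr : 0 < r) (i j : ℕ) :
    ∃ i' j' k', Reduced p q r i' j' ∧ i' * p + j' * q + k' * r = i * p + j * q := by
  induction hn : i * p + j * q using Nat.strong_induction_on generalizing i j with
  | _ n ih =>
    subst hn
    induction i using Nat.strong_induction_on generalizing j with
    | _ i ih2 =>
      by_cases h : Reduced p q r i j
      · exact ⟨i, j, 0, h, by ring⟩
      · simp only [Reduced] at h
        push Not at h
        obtain ⟨x, y, z, he, hz⟩ := h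
        rcases Nat.eq_zero_or_pos z with rfl | hzpos
        · have he' : x * p + y * q = i * p + j * q := by linear_combination he
          obtain ⟨i', j', k', h1, h2⟩ := ih2 x (hz rfl) y (fun m hm a b hab =>
            ih m (he' ▸ hm) a b hab)
          exact ⟨i', j', k', h1, h2.trans he'⟩
        · have hpos : 0 < z * r := Nat.mul_pos hzpos hr
          obtain ⟨i', j', k', h1, h2⟩ := ih (x * p + y * q) (by omega) x y rfl
          exact ⟨i', j', k' + z, h1, by linear_combination h2 + he⟩

theorem reduced_zero (hr : 0 < r) : Reduced p q r 0 0 := by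
  intro x y z h
  have h1 : z * r = 0 := by nlinarith [Nat.zero_le (x * p), Nat.zero_le (y * q)]
  exact ⟨by rcases Nat.mul_eq_zero.mp h1 with h | h <;> omega, Nat.zero_le _⟩

/-- A minimal non-reduced exponent whose neighbour below in the first direction is reduced. -/
theorem Reduced.fst_eq_zero (hq : 0 < q) {i j x y z : ℕ} (hn : ¬ Reduced p q r (i + 1) j)
    (h : Reduced p q r i j) (hxy : Reduced p q r x y)
    (he : x * p + y * q + z * r = (i + 1) * p + j * q) : x = 0 := by
  by_contra hx
  obtain ⟨x, rfl⟩ := Nat.exists_eq_succ_of_ne_zero hx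
  -- Cancelling one `p` leaves two reduced representations of the same number, so `(x + 1, y)` would
  -- be the non-reduced exponent itself.
  obtain ⟨rfl, rfl, rfl⟩ := Reduced.unique (k := 0) hq h (hxy.mono x.le_succ le_rfl)
    (k' := z) (by simp only [Nat.succ_eq_add_one] at he; linear_combination -he)
  exact hn hxy

theorem Reduced.snd_eq_zero (hq : 0 < q) {i j x y z : ℕ} (hn : ¬ Reduced p q r i (j + 1))
    (h : Reduced p q r i j) (hxy : Reduced p q r x y)
    (he : x * p + y * q + z * r = i * p + (j + 1) * q) : y = 0 := by
  by_contra hy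
  obtain ⟨y, rfl⟩ := Nat.exists_eq_succ_of_ne_zero hy
  obtain ⟨rfl, rfl, rfl⟩ := Reduced.unique (k := 0) hq h (hxy.mono le_rfl y.le_succ)
    (k' := z) (by simp only [Nat.succ_eq_add_one] at he; linear_combination -he)
  exact hn hxy

/-- The set of reduced exponents is a rectangle or an L-shape. -/
theorem reduced_shape (hq : 0 < q) (hr : 0 < r) :
    ∃ l h : ℕ, 0 < l ∧ 0 < h ∧
      (∃ j k, j < h ∧ l * p = j * q + k * r) ∧ (∃ i k, i < l ∧ h * q = i * p + k * r) ∧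
      ((∀ i j, Reduced p q r i j ↔ i < l ∧ j < h) ∨
        ∃ l' h' k, 0 < l' ∧ 0 < h' ∧ l' < l ∧ h' < h ∧ l' * p + h' * q = k * r ∧
          ∀ i j, Reduced p q r i j ↔ i < l ∧ j < h ∧ (i < l' ∨ j < h')) := by
  classical
  have h0 : Reduced p q r 0 0 := reduced_zero hr
  -- The relation `r * p = p * r` shows that the exponent `r` is not reduced.
  have hl : ∃ l, ¬ Reduced p q r l 0 := ⟨r, fun hh => by
    have := hh 0 0 p (by ring)
    omega⟩
  have hh : ∃ h, ¬ Reduced p q r 0 h := ⟨r, fun hh => by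
    have := hh 0 0 q (by ring)
    omega⟩
  obtain ⟨l, hlspec, hlmin⟩ : ∃ l, ¬ Reduced p q r l 0 ∧ ∀ i < l, Reduced p q r i 0 :=
    ⟨Nat.find hl, Nat.find_spec hl, fun i hi => not_not.mp (Nat.find_min hl hi)⟩
  obtain ⟨h, hhspec, hhmin⟩ : ∃ l, ¬ Reduced p q r 0 l ∧ ∀ i < l, Reduced p q r 0 i :=
    ⟨Nat.find hh, Nat.find_spec hh, fun i hi => not_not.mp (Nat.find_min hh hi)⟩
  have hlpos : 0 < l := Nat.pos_of_ne_zero (by rintro rfl; exact hlspec h0)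
  have hhpos : 0 < h := Nat.pos_of_ne_zero (by rintro rfl; exact hhspec h0)
  have hlt : ∀ {i j}, Reduced p q r i j → i < l ∧ j < h := by
    intro i j hij
    constructor
    · by_contra hc
      exact hlspec (hij.mono (not_lt.mp hc) (Nat.zero_le _))
    · by_contra hc
      exact hhspec (hij.mono (Nat.zero_le _) (not_lt.mp hc))
  refine ⟨l, h, hlpos, hhpos, ?_, ?_, ?_⟩
  · obtain ⟨x, y, z, hxy, he⟩ := exists_reduced (p := p) (q := q) hr l 0
    obtain ⟨i, rfl⟩ := Nat.exists_eq_succ_of_ne_zero hlpos.ne'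
    obtain rfl := Reduced.fst_eq_zero hq hlspec (hlmin i (Nat.lt_succ_self i)) hxy he
    exact ⟨y, z, (hlt hxy).2, by linear_combination -he⟩
  · obtain ⟨x, y, z, hxy, he⟩ := exists_reduced (p := p) (q := q) hr 0 h
    obtain ⟨i, rfl⟩ := Nat.exists_eq_succ_of_ne_zero hhpos.ne'
    obtain rfl := Reduced.snd_eq_zero hq hhspec (hhmin i (Nat.lt_succ_self i)) hxy he
    exact ⟨x, z, (hlt hxy).1, by linear_combination -he⟩
  · by_cases hall : ∀ i j, i < l → j < h → Reduced p q r i j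
    · exact Or.inl fun i j => ⟨fun hij => hlt hij, fun hij => hall i j hij.1 hij.2⟩
    right
    -- minimal non-reduced exponents inside the box
    have hmin : ∀ i j, i < l → j < h → ¬ Reduced p q r i j → ∃ a b k, a ≤ i ∧ b ≤ j ∧
        0 < a ∧ 0 < b ∧ a * p + b * q = k * r ∧ ¬ Reduced p q r a b ∧
        ∀ x y, x ≤ a → y ≤ b → (x, y) ≠ (a, b) → Reduced p q r x y := by
      intro i j hi hj hij
      have ha : ∃ a, ¬ Reduced p q r a j := ⟨i, hij⟩
      obtain ⟨a, ha1, ha2⟩ : ∃ a, ¬ Reduced p q r a j ∧ ∀ x < a, Reduced p q r x j :=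
        ⟨Nat.find ha, Nat.find_spec ha, fun i hi => not_not.mp (Nat.find_min ha hi)⟩
      have hai : a ≤ i := by
        by_contra hc
        exact hij (ha2 i (not_le.mp hc))
      have hb : ∃ b, ¬ Reduced p q r a b := ⟨j, ha1⟩
      obtain ⟨b, hb1, hb2⟩ : ∃ b, ¬ Reduced p q r a b ∧ ∀ x < b, Reduced p q r a x :=
        ⟨Nat.find hb, Nat.find_spec hb, fun i hi => not_not.mp (Nat.find_min hb hi)⟩
      have hbj : b ≤ j := by
        by_contra hc
        exact ha1 (hb2 j (not_le.mp hc))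
      have hapos : 0 < a := Nat.pos_of_ne_zero (by rintro rfl; exact hb1 (hhmin b (by omega)))
      have hbpos : 0 < b := Nat.pos_of_ne_zero (by rintro rfl; exact hb1 (hlmin a (by omega)))
      have hred : ∀ x y, x ≤ a → y ≤ b → (x, y) ≠ (a, b) → Reduced p q r x y := by
        intro x y hx hy hne
        rcases hx.lt_or_eq with hx' | rfl
        · exact (ha2 x hx').mono le_rfl (hy.trans hbj)
        · exact hb2 y (lt_of_le_of_ne hy fun e => hne (by rw [e]))
      obtain ⟨x, y, z, hxy, he⟩ := exists_reduced (p := p) (q := q) hr a b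
      obtain ⟨a, rfl⟩ := Nat.exists_eq_succ_of_ne_zero hapos.ne'
      obtain ⟨b, rfl⟩ := Nat.exists_eq_succ_of_ne_zero hbpos.ne'
      obtain rfl := Reduced.fst_eq_zero hq hb1 (hred a _ a.le_succ le_rfl (by simp)) hxy he
      obtain rfl := Reduced.snd_eq_zero hq hb1 (hred _ b le_rfl b.le_succ (by simp)) hxy he
      exact ⟨_, _, z, hai, hbj, hapos, hbpos, by linear_combination -he, hb1, hred⟩
    push Not at hall
    obtain ⟨i, j, hi, hj, hij⟩ := hall
    obtain ⟨l', h', k, hl', hh', hl'pos, hh'pos, hk, hnr, hm⟩ := hmin i j hi hj hij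
    refine ⟨l', h', k, hl'pos, hh'pos, by omega, by omega, hk, fun i j => ⟨fun hij => ?_, ?_⟩⟩
    · refine ⟨(hlt hij).1, (hlt hij).2, ?_⟩
      by_contra hc
      push Not at hc
      exact hnr (hij.mono hc.1 hc.2)
    · rintro ⟨hi, hj, hor⟩
      by_contra hij
      obtain ⟨a, b, k2, ha, hb, hapos, hbpos, hk2, hnr2, hm2⟩ := hmin i j hi hj hij
      -- There is only one inner corner. Both corners have values that are multiples of `r`; for two
      -- incomparable ones, subtracting the relations gives a representation over some `(c + 1, 0)`
      -- equal to one over some `(0, e + 1)`. Both exponents are reduced, against uniqueness.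
      have hab : (a, b) = (l', h') := by
        by_contra hne
        have h1 : ¬ (a ≤ l' ∧ b ≤ h') := fun hc => hnr2 (hm a b hc.1 hc.2 hne)
        have h2 : ¬ (l' ≤ a ∧ h' ≤ b) := fun hc => hnr (hm2 l' h' hc.1 hc.2 (Ne.symm hne))
        rcases lt_or_ge l' a with hla | hla
        · have hhb : b < h' := by
            by_contra hc
            exact h2 ⟨hla.le, not_lt.mp hc⟩
          obtain ⟨c, rfl⟩ := Nat.exists_eq_add_of_lt hla
          obtain ⟨e, rfl⟩ := Nat.exists_eq_add_of_lt hhb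
          have := Reduced.unique hq (hlmin (c + 1) (by omega)) (hhmin (e + 1) (by omega))
            (k := k) (k' := k2) (by linear_combination hk2 - hk)
          omega
        · have hbh : h' < b := by
            by_contra hc
            exact h1 ⟨hla, not_lt.mp hc⟩
          have hla' : a < l' := by
            by_contra hc
            exact h2 ⟨not_lt.mp hc, hbh.le⟩
          obtain ⟨c, rfl⟩ := Nat.exists_eq_add_of_lt hla'
          obtain ⟨e, rfl⟩ := Nat.exists_eq_add_of_lt hbh
          have := Reduced.unique hq (hlmin (c + 1) (by omega)) (hhmin (e + 1) (by omega))
            (k := k2) (k' := k) (by linear_combination hk - hk2)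
          omega
      obtain ⟨rfl, rfl⟩ := Prod.mk.inj hab
      omega

end Reduced

/-! ### The numerator of the Hilbert series from the shape of the Apéry set. -/

/-- Multiplying by `1 - X ^ d 2` keeps just those `n` in the semigroup for which `n - d 2` is not in
it. Each of them is the value of exactly one reduced exponent. -/
theorem hilbert_mul_one_sub {d : Fin 3 → ℕ} (hd : Admissible d) {L : Finset (ℕ × ℕ)}
    (hL : ∀ x, x ∈ L ↔ Reduced (d 0) (d 1) (d 2) x.1 x.2) :
    hilbert d * (1 - (PowerSeries.X : PowerSeries ℤ) ^ d 2) =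
      ∑ x ∈ L, PowerSeries.X ^ (x.1 * d 0 + x.2 * d 1) := by
  classical
  ext n
  rw [mul_sub, mul_one, map_sub, PowerSeries.coeff_mul_X_pow', map_sum]
  simp only [hilbert, PowerSeries.coeff_mk, PowerSeries.coeff_X_pow]
  have hsucc : ∀ m, m + d 2 = n → m ∈ semigroup d → n ∈ semigroup d := by
    rintro m rfl hm
    obtain ⟨a, b, c, rfl⟩ := mem_semigroup_iff.mp hm
    exact mem_semigroup_iff.mpr ⟨a, b, c + 1, by ring⟩
  by_cases hn : n ∈ semigroup d
  · obtain ⟨a, b, c, habc⟩ := mem_semigroup_iff.mp hn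
    obtain ⟨i, j, k, hij, he⟩ := exists_reduced (p := d 0) (q := d 1) (pos hd 2) a b
    have he2 : i * d 0 + j * d 1 + (k + c) * d 2 = n := by linear_combination he + habc
    generalize k + c = k at he2
    rcases Nat.eq_zero_or_pos k with rfl | hk
    · rw [Finset.sum_eq_single (i, j)]
      · have h2 : ¬ (d 2 ≤ n ∧ n - d 2 ∈ semigroup d) := by
          rintro ⟨h1, h2⟩
          obtain ⟨x, y, z, hxyz⟩ := mem_semigroup_iff.mp h2
          have h3 : x * d 0 + y * d 1 + (z + 1) * d 2 = n := by
            rw [add_mul, ← add_assoc, hxyz, one_mul, Nat.sub_add_cancel h1]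
          have := hij x y (z + 1) (by linear_combination h3 - he2)
          omega
        rw [if_pos hn, if_pos (show n = (i, j).1 * d 0 + (i, j).2 * d 1 by linear_combination -he2)]
        by_cases h1 : d 2 ≤ n
        · rw [if_pos h1, if_neg fun h3 => h2 ⟨h1, h3⟩, sub_zero]
        · rw [if_neg h1, sub_zero]
      · rintro ⟨x, y⟩ hx hne
        apply if_neg
        rintro rfl
        have := Reduced.unique (pos hd 1) hij ((hL _).mp hx) (k := 0) (k' := 0)
          (by linear_combination he2)
        exact hne (by rw [this.1, this.2.1])
      · intro h
        exact absurd ((hL (i, j)).mpr hij) h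
    · obtain ⟨k, rfl⟩ := Nat.exists_eq_succ_of_ne_zero hk.ne'
      rw [Finset.sum_eq_zero]
      · have h1 : i * d 0 + j * d 1 + k * d 2 + d 2 = n := by
          rw [← he2, Nat.succ_eq_add_one]
          ring
        rw [if_pos hn, if_pos (by omega), if_pos, sub_self]
        exact mem_semigroup_iff.mpr ⟨i, j, k, by omega⟩
      · rintro ⟨x, y⟩ hx
        apply if_neg
        rintro rfl
        have := (hL _).mp hx _ _ _ he2
        omega
  · rw [if_neg hn, Finset.sum_eq_zero]
    · by_cases h1 : d 2 ≤ n
      · rw [if_pos h1, if_neg, sub_zero]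
        exact fun h2 => hn (hsucc _ (Nat.sub_add_cancel h1) h2)
      · rw [if_neg h1, sub_zero]
    · rintro ⟨x, y⟩ -
      apply if_neg
      rintro rfl
      exact hn (mem_semigroup_iff.mpr ⟨x, y, 0, by ring⟩)

open PowerSeries in
theorem numerator_of_shape {d : Fin 3 → ℕ} (hd : Admissible d) {l h l' h' : ℕ}
    (hl : l' ≤ l) (hh : h' ≤ h)
    (hred : ∀ i j, Reduced (d 0) (d 1) (d 2) i j ↔ i < l ∧ j < h ∧ (i < l' ∨ j < h')) :
    hilbert d * ∏ i, (1 - (PowerSeries.X : PowerSeries ℤ) ^ d i) =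
      (1 - X ^ (l * d 0)) * (1 - X ^ (h' * d 1)) +
        (1 - X ^ (l' * d 0)) * (X ^ (h' * d 1) - X ^ (h * d 1)) := by
  -- The L-shape is cut into two rectangles, each summed as a product of geometric series.
  have hdisj : Disjoint (Finset.range l ×ˢ Finset.range h')
      (Finset.range l' ×ˢ Finset.Ico h' h) := by
    rw [Finset.disjoint_left]
    rintro ⟨i, j⟩ h1 h2
    simp at h1 h2
    omega
  have h1 := hilbert_mul_one_sub hd
    (L := (Finset.range l ×ˢ Finset.range h') ∪ (Finset.range l' ×ˢ Finset.Ico h' h))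
    (by
      rintro ⟨i, j⟩
      rw [hred]
      simp
      omega)
  rw [Finset.sum_union hdisj, Finset.sum_product, Finset.sum_product] at h1
  simp only [pow_add, ← Finset.mul_sum, ← Finset.sum_mul, mul_comm _ (d 0), mul_comm _ (d 1),
    pow_mul] at h1 ⊢
  have e1 := geom_sum_mul_neg ((X : ℤ⟦X⟧) ^ d 0) l
  have e2 := geom_sum_mul_neg ((X : ℤ⟦X⟧) ^ d 0) l'
  have e3 := geom_sum_mul_neg ((X : ℤ⟦X⟧) ^ d 1) h'
  have e4 := geom_sum_Ico_mul_neg ((X : ℤ⟦X⟧) ^ d 1) hh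
  rw [Fin.prod_univ_three, ← e1, ← e2, ← e3, ← e4]
  linear_combination (1 - X ^ d 0) * (1 - X ^ d 1) * h1

/-- The numerator of the Hilbert series for three generators. -/
theorem numerator_cases {d : Fin 3 → ℕ} (hd : Admissible d) :
    (∃ a b : ℕ, 0 < a ∧ 0 < b ∧
      hilbert d * ∏ i, (1 - (PowerSeries.X : PowerSeries ℤ) ^ d i) =
        ((1 - Polynomial.X ^ a - Polynomial.X ^ b + Polynomial.X ^ (a + b) :
          Polynomial ℤ) : PowerSeries ℤ)) ∨
    (∃ x₁ x₂ x₃ y₁ y₂ : ℕ, x₁ < y₁ ∧ x₂ < y₁ ∧ x₃ < y₁ ∧ x₁ < y₂ ∧ x₂ < y₂ ∧ x₃ < y₂ ∧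
      hilbert d * ∏ i, (1 - (PowerSeries.X : PowerSeries ℤ) ^ d i) =
        ((1 - Polynomial.X ^ x₁ - Polynomial.X ^ x₂ - Polynomial.X ^ x₃
          + Polynomial.X ^ y₁ + Polynomial.X ^ y₂ : Polynomial ℤ) : PowerSeries ℤ)) := by
  have hp := pos hd 0
  have hq := pos hd 1
  have hr := pos hd 2
  obtain ⟨l, h, hl, hh, ⟨j, k, hj, hjk⟩, ⟨i, m, hi, him⟩, hs⟩ :=
    reduced_shape (p := d 0) hq hr
  rcases hs with hs | ⟨l', h', k', hl', hh', hll, hhh, hk', hs⟩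
  · left
    refine ⟨l * d 0, h * d 1, Nat.mul_pos hl hp, Nat.mul_pos hh hq, ?_⟩
    rw [numerator_of_shape hd (le_refl l) (le_refl h) (fun i j => by rw [hs]; omega)]
    push_cast
    ring
  · have hP := numerator_of_shape hd hll.le hhh.le hs
    have hP' : hilbert d * ∏ i, (1 - (PowerSeries.X : PowerSeries ℤ) ^ d i) =
        ((1 - Polynomial.X ^ (l * d 0) - Polynomial.X ^ (h * d 1)
          - Polynomial.X ^ (l' * d 0 + h' * d 1)
          + Polynomial.X ^ (l * d 0 + h' * d 1) + Polynomial.X ^ (l' * d 0 + h * d 1) :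
          Polynomial ℤ) : PowerSeries ℤ) := by
      rw [hP]
      push_cast
      ring
    have h2 := coeff_numerator_two hd hP'
    simp only [map_add, map_sub, map_one, map_pow, Polynomial.aeval_X, coeff_aeval_exp_X_pow,
      PowerSeries.coeff_one, prodGen, Fin.prod_univ_three] at h2
    norm_num [Nat.factorial] at h2
    -- The `z²` coefficient says that the L-shaped region has `d 2` points, one for each residue
    -- class modulo `d 2`.
    have harea : l * h' + l' * h = d 2 + l' * h' := by
      have hpq : (0 : ℝ) < d 0 * d 1 := by positivity
      have : ((l * h' + l' * h : ℕ) : ℝ) = ((d 2 + l' * h' : ℕ) : ℝ) := by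
        apply mul_left_cancel₀ hpq.ne'
        push_cast
        linear_combination h2
      exact_mod_cast this
    have hdvd : ∀ n, d 2 ∣ n * d 0 → d 2 ∣ n * d 1 → d 2 ∣ n := by
      intro n h0 h1
      have h3 : d 2 ∣ n * Nat.gcd (d 0) (d 1) := by
        rw [← Nat.gcd_mul_left]
        exact Nat.dvd_gcd h0 h1
      have hc : Nat.Coprime (d 2) (Nat.gcd (d 0) (d 1)) :=
        (Nat.coprime_comm.mp hd.gcd_eq_one)
      exact hc.dvd_of_dvd_mul_right h3
    have hll' : l' * h' < l * h' := Nat.mul_lt_mul_of_pos_right hll hh'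
    have hhh' : l' * h' < l' * h := Nat.mul_lt_mul_of_pos_left hhh hl'
    have hunique : ∀ n, 0 < n → n < 2 * d 2 → d 2 ∣ n → n = d 2 := by
      rintro n h0 h1 ⟨c, rfl⟩
      have : c < 2 := by
        by_contra hc
        have := Nat.mul_le_mul_left (d 2) (not_lt.mp hc)
        omega
      have : c ≠ 0 := by
        rintro rfl
        omega
      obtain rfl : c = 1 := by omega
      ring
    obtain ⟨u, rfl⟩ := Nat.exists_eq_add_of_lt hll
    obtain ⟨w, rfl⟩ := Nat.exists_eq_add_of_lt hhh
    -- The determinant `l h' + j l'` of two relations modulo `d 2` annihilates `d 0` and `d 1`, so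
    -- `d 2` divides it. It lies strictly between `0` and `2 d 2`, hence equals `d 2`; comparison
    -- with `harea` gives `j = h - h'`.
    have hjw : j = w + 1 := by
      have h4 : j * l' < (h' + w + 1) * l' := Nat.mul_lt_mul_of_pos_right hj hl'
      have h5 : (l' + u + 1) * h' + j * l' = d 2 := by
        apply hunique
        · positivity
        · nlinarith
        · apply hdvd
          · refine ⟨k' * j + k * h', ?_⟩
            linear_combination j * hk' + h' * hjk
          · refine (Nat.dvd_add_right (Dvd.intro_left (l' * k) rfl : d 2 ∣ l' * k * d 2)).mp ?_
            refine ⟨k' * (l' + u + 1), ?_⟩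
            linear_combination (l' + u + 1) * hk' - l' * hjk
      have h6 : l' * j = l' * (w + 1) := by linear_combination h5 - harea
      exact Nat.eq_of_mul_eq_mul_left hl' h6
    have hiu : i = u + 1 := by
      have h4 : i * h' < (l' + u + 1) * h' := Nat.mul_lt_mul_of_pos_right hi hh'
      have h5 : (h' + w + 1) * l' + i * h' = d 2 := by
        apply hunique
        · positivity
        · nlinarith
        · apply hdvd
          · refine (Nat.dvd_add_right (Dvd.intro_left (h' * m) rfl : d 2 ∣ h' * m * d 2)).mp ?_
            refine ⟨k' * (h' + w + 1), ?_⟩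
            linear_combination (h' + w + 1) * hk' - h' * him
          · refine ⟨k' * i + m * l', ?_⟩
            linear_combination i * hk' + l' * him
      have h6 : h' * i = h' * (u + 1) := by linear_combination h5 - harea
      exact Nat.eq_of_mul_eq_mul_left hh' h6
    subst hjw hiu
    -- The two sides differ by `m * d 2`, and those of `hle2` by `k * d 2`. If a difference
    -- vanishes, a pair of terms cancels and the numerator factors, so this L-shape belongs to the
    -- first alternative.
    have hle1 : (l' + u + 1) * d 0 ≤ l' * d 0 + (h' + w + 1) * d 1 := by
      rw [him]
      exact le_of_le_of_eq (Nat.le_add_right _ (m * d 2)) (by ring)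
    have hle2 : (h' + w + 1) * d 1 ≤ (l' + u + 1) * d 0 + h' * d 1 := by
      rw [hjk]
      exact le_of_le_of_eq (Nat.le_add_right _ (k * d 2)) (by ring)
    have hp1 : 0 < l' * d 0 := by positivity
    have hp2 : 0 < h' * d 1 := by positivity
    rcases hle1.lt_or_eq with hlt1 | he1
    · rcases hle2.lt_or_eq with hlt2 | he2
      · right
        refine ⟨_, _, _, _, _, ?_, hlt2, ?_, hlt1, ?_, ?_, hP'⟩
        · omega
        · have := Nat.mul_lt_mul_of_pos_right hll hp
          omega
        · omega
        · have := Nat.mul_lt_mul_of_pos_right hhh hq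
          omega
      · left
        refine ⟨(l' + u + 1) * d 0, l' * d 0 + h' * d 1, by positivity, by positivity, ?_⟩
        rw [hP', he2]
        have e3 : l' * d 0 + ((l' + u + 1) * d 0 + h' * d 1) =
          (l' + u + 1) * d 0 + (l' * d 0 + h' * d 1) := by ring
        rw [e3]
        congr 1
        ring
    · left
      refine ⟨(h' + w + 1) * d 1, l' * d 0 + h' * d 1, by positivity, by positivity, ?_⟩
      rw [hP', he1]
      have e3 : l' * d 0 + (h' + w + 1) * d 1 + h' * d 1 =
        (h' + w + 1) * d 1 + (l' * d 0 + h' * d 1) := by ring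
      rw [e3]
      congr 1
      ring

/-! ### Rescaled genera computed from the exponents of the numerator. -/

theorem K_eq_of_coeff {d : Fin 3 → ℕ} (hd : Admissible d) {P : Polynomial ℤ}
    (hP : hilbert d * ∏ i, (1 - (PowerSeries.X : PowerSeries ℤ) ^ d i) = P) {r : ℕ} {N : ℝ}
    (hN : PowerSeries.coeff (r + 3) (Polynomial.aeval (PowerSeries.exp ℝ) P) =
      N / ((r + 3).factorial : ℝ)) :
    K d r = N / ((r + 1) * (r + 2) * (r + 3) * prodGen d) := by
  have hπ : (prodGen d : ℝ) ≠ 0 := by exact_mod_cast (prodGen_pos hd).ne'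
  rw [coeff_numerator_K hd hP, Nat.factorial_succ, Nat.factorial_succ, Nat.factorial_succ] at hN
  have h1 : (r.factorial : ℝ) ≠ 0 := by exact_mod_cast r.factorial_ne_zero
  have h2 : (r : ℝ) + 1 ≠ 0 := by positivity
  have h3 : (r : ℝ) + 2 ≠ 0 := by positivity
  have h4 : (r : ℝ) + 3 ≠ 0 := by positivity
  push_cast at hN
  rw [show (r : ℝ) + 2 + 1 = r + 3 by ring, show (r : ℝ) + 1 + 1 = r + 2 by ring] at hN
  rw [eq_div_iff (by positivity)]
  rw [← mul_div_assoc, div_eq_div_iff h1 (by positivity)] at hN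
  apply mul_left_cancel₀ h1
  linear_combination hN

/-- The rescaled genera when the numerator is `(1 - t^a)(1 - t^b)`, with `α = a / g`. -/
theorem h_of_product {d : Fin 3 → ℕ} (hd : Admissible d) {a b : ℕ} (ha : 0 < a) (hb : 0 < b)
    (hP : hilbert d * ∏ i, (1 - (PowerSeries.X : PowerSeries ℤ) ^ d i) =
        ((1 - Polynomial.X ^ a - Polynomial.X ^ b + Polynomial.X ^ (a + b) :
          Polynomial ℤ) : PowerSeries ℤ)) :
    a + b = g d ∧ ∃ α : ℝ, 0 < α ∧ α < 1 ∧ v d = α * (1 - α) ∧ ∀ r : ℕ,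
      h d r = (1 - α ^ (r + 3) - (1 - α) ^ (r + 3)) /
        ((r + 1) * (r + 2) * (r + 3) * (α * (1 - α))) := by
  have hdeg := (monic_numerator hd hP).2
  have hdeg' : (1 - Polynomial.X ^ a - Polynomial.X ^ b + Polynomial.X ^ (a + b) :
      Polynomial ℤ).natDegree = a + b := by
    apply Polynomial.natDegree_eq_of_le_of_coeff_ne_zero
    · rw [Polynomial.natDegree_le_iff_coeff_eq_zero]
      intro n hn
      simp [Polynomial.coeff_X_pow, Polynomial.coeff_one, show n ≠ 0 by omega,
        show n ≠ a by omega, show n ≠ b by omega, show n ≠ a + b by omega]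
    · simp [Polynomial.coeff_X_pow, Polynomial.coeff_one, ha.ne', hb.ne']
  have hg : a + b = g d := hdeg'.symm.trans hdeg
  have hcoeff : ∀ n, n ≠ 0 → PowerSeries.coeff n (Polynomial.aeval (PowerSeries.exp ℝ)
      (1 - Polynomial.X ^ a - Polynomial.X ^ b + Polynomial.X ^ (a + b) : Polynomial ℤ)) =
      ((g d : ℝ) ^ n - a ^ n - b ^ n) / n.factorial := by
    intro n hn
    simp only [map_add, map_sub, map_one, map_pow, Polynomial.aeval_X, coeff_aeval_exp_X_pow,
      PowerSeries.coeff_one, if_neg hn, hg]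
    ring
  have hgp : (0 : ℝ) < g d := by exact_mod_cast g_pos hd
  have ha' : (0 : ℝ) < a := by exact_mod_cast ha
  have hb' : (0 : ℝ) < b := by exact_mod_cast hb
  have hgr : (a : ℝ) + b = g d := by exact_mod_cast hg
  have hπ : (prodGen d : ℝ) = a * b := by
    rw [← coeff_numerator_two hd hP, hcoeff 2 (by norm_num), ← hgr]
    norm_num [Nat.factorial]
    ring
  have hbα : (1 : ℝ) - a / g d = b / g d := by
    rw [← hgr]
    field_simp
    ring
  refine ⟨hg, a / g d, by positivity, ?_, ?_, fun r => ?_⟩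
  · rw [div_lt_one hgp, ← hgr]
    linarith
  · rw [v, hπ, hbα]
    field_simp
  · rw [h, K_eq_of_coeff hd hP (hcoeff (r + 3) (by omega)), hπ, hbα]
    have h2 : (r : ℝ) + 1 ≠ 0 := by positivity
    have h3 : (r : ℝ) + 2 ≠ 0 := by positivity
    have h4 : (r : ℝ) + 3 ≠ 0 := by positivity
    simp only [div_pow]
    field_simp
    ring

/-- The rescaled genera when the numerator has six terms, with `ξᵢ = xᵢ / g`, `w = y / g`. -/
theorem h_of_six_terms {d : Fin 3 → ℕ} (hd : Admissible d) {x₁ x₂ x₃ y₁ y₂ : ℕ}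
    (h₁ : x₁ < y₁) (h₂ : x₂ < y₁) (h₃ : x₃ < y₁) (hy : y₁ ≤ y₂)
    (hP : hilbert d * ∏ i, (1 - (PowerSeries.X : PowerSeries ℤ) ^ d i) =
        ((1 - Polynomial.X ^ x₁ - Polynomial.X ^ x₂ - Polynomial.X ^ x₃
          + Polynomial.X ^ y₁ + Polynomial.X ^ y₂ : Polynomial ℤ) : PowerSeries ℤ)) :
    ∃ ξ₁ ξ₂ ξ₃ w : ℝ, ξ₁ < w ∧ ξ₂ < w ∧ ξ₃ < w ∧ w < 1 ∧ ξ₁ + ξ₂ + ξ₃ = 1 + w ∧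
      2 * v d = 1 + w ^ 2 - ξ₁ ^ 2 - ξ₂ ^ 2 - ξ₃ ^ 2 ∧ ∀ r : ℕ,
      h d r = (1 + w ^ (r + 3) - ξ₁ ^ (r + 3) - ξ₂ ^ (r + 3) - ξ₃ ^ (r + 3)) /
        ((r + 1) * (r + 2) * (r + 3) * v d) := by
  obtain ⟨hm, hdeg⟩ := monic_numerator hd hP
  set P := (1 - Polynomial.X ^ x₁ - Polynomial.X ^ x₂ - Polynomial.X ^ x₃
          + Polynomial.X ^ y₁ + Polynomial.X ^ y₂ : Polynomial ℤ) with hPdef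
  have hc : P.coeff y₂ = if y₁ = y₂ then 2 else 1 := by
    simp [hPdef, Polynomial.coeff_X_pow, Polynomial.coeff_one, show y₂ ≠ 0 by omega,
      show y₂ ≠ x₁ by omega, show y₂ ≠ x₂ by omega, show y₂ ≠ x₃ by omega, eq_comm (a := y₂)]
    split_ifs <;> norm_num
  have hdeg' : P.natDegree = y₂ := by
    apply Polynomial.natDegree_eq_of_le_of_coeff_ne_zero
    · rw [Polynomial.natDegree_le_iff_coeff_eq_zero]
      intro n hn
      simp [hPdef, Polynomial.coeff_X_pow, Polynomial.coeff_one, show n ≠ 0 by omega,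
        show n ≠ x₁ by omega, show n ≠ x₂ by omega, show n ≠ x₃ by omega,
        show n ≠ y₁ by omega, show n ≠ y₂ by omega]
    · rw [hc]
      split_ifs <;> norm_num
  -- Equal top exponents would give leading coefficient `2`, but the numerator is monic.
  have hne : y₁ ≠ y₂ := by
    intro he
    rw [if_pos he, ← hdeg', Polynomial.coeff_natDegree, hm.leadingCoeff] at hc
    norm_num at hc
  obtain rfl : y₂ = g d := hdeg'.symm.trans hdeg
  have hcoeff : ∀ n, n ≠ 0 → PowerSeries.coeff n (Polynomial.aeval (PowerSeries.exp ℝ) P) =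
      ((g d : ℝ) ^ n + y₁ ^ n - x₁ ^ n - x₂ ^ n - x₃ ^ n) / n.factorial := by
    intro n hn
    simp only [hPdef, map_add, map_sub, map_one, map_pow, Polynomial.aeval_X,
      coeff_aeval_exp_X_pow, PowerSeries.coeff_one, if_neg hn]
    ring
  have hgp : (0 : ℝ) < g d := by exact_mod_cast g_pos hd
  have h1 := coeff_numerator_one hd hP
  have h2 := coeff_numerator_two hd hP
  rw [hcoeff 1 (by norm_num)] at h1
  rw [hcoeff 2 (by norm_num)] at h2
  norm_num [Nat.factorial] at h1 h2
  have hlt : ∀ {s t : ℕ}, s < t → (s : ℝ) / g d < t / g d := fun hst =>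
    div_lt_div_of_pos_right (by exact_mod_cast hst) hgp
  refine ⟨x₁ / g d, x₂ / g d, x₃ / g d, y₁ / g d, hlt h₁, hlt h₂, hlt h₃, ?_, ?_, ?_,
    fun r => ?_⟩
  · rw [div_lt_one hgp]
    exact_mod_cast lt_of_le_of_ne hy hne
  · field_simp
    linarith
  · rw [v]
    field_simp
    linarith
  · rw [h, K_eq_of_coeff hd hP (hcoeff (r + 3) (by omega)), v]
    have hπ : (prodGen d : ℝ) ≠ 0 := by exact_mod_cast (prodGen_pos hd).ne'
    have h2 : (r : ℝ) + 1 ≠ 0 := by positivity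
    have h3 : (r : ℝ) + 2 ≠ 0 := by positivity
    have h4 : (r : ℝ) + 3 ≠ 0 := by positivity
    simp only [div_pow]
    field_simp
    ring

theorem v_pos {d : Fin 3 → ℕ} (hd : Admissible d) : 0 < v d := by
  have h1 : (0 : ℝ) < prodGen d := by exact_mod_cast prodGen_pos hd
  have h2 : (0 : ℝ) < g d := by exact_mod_cast g_pos hd
  rw [v]
  positivity

/-- `h₀, …, h₃` in terms of `v`, `w` and one further parameter `q`. -/
theorem h_of_six_terms_reduced {d : Fin 3 → ℕ} (hd : Admissible d) {ξ₁ ξ₂ ξ₃ w : ℝ}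
    (h₁ : ξ₁ < w) (h₂ : ξ₂ < w) (h₃ : ξ₃ < w) (hw : w < 1) (hsum : ξ₁ + ξ₂ + ξ₃ = 1 + w)
    (hv : 2 * v d = 1 + w ^ 2 - ξ₁ ^ 2 - ξ₂ ^ 2 - ξ₃ ^ 2)
    (hh : ∀ r : ℕ, h d r = (1 + w ^ (r + 3) - ξ₁ ^ (r + 3) - ξ₂ ^ (r + 3) - ξ₃ ^ (r + 3)) /
        ((r + 1) * (r + 2) * (r + 3) * v d)) :
    ∃ q : ℝ, 0 < q ∧ q < 1 / 9 ∧ v d < 1 / 3 ∧ 0 < w ∧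
      h d 0 = (1 + q) / 2 ∧
      h d 1 = (1 + q * (1 + w) - v d / 2) / 6 ∧
      h d 2 = (1 + q * (1 + w + w ^ 2) - v d * (1 + q)) / 12 ∧
      h d 3 = (1 + q * (1 + w + w ^ 2 + w ^ 3) - v d * (1 + q * (1 + w) + (1 + q) ^ 2 / 2)
        + v d ^ 2 / 3) / 20 := by
  have hvp := v_pos hd
  have hwp : 0 < w := by linarith
  set V := v d with hV
  have hB : 0 < (w - ξ₁) * (w - ξ₂) * (w - ξ₃) :=
    mul_pos (mul_pos (sub_pos.mpr h₁) (sub_pos.mpr h₂)) (sub_pos.mpr h₃)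
  -- The elementary symmetric functions of the `ξᵢ` are `1 + w`, `w + V` and `V (w - q)`, so their
  -- power sums are polynomials in `V`, `w`, `q`.
  obtain ⟨q, hq⟩ : ∃ q, V * q = (w - ξ₁) * (w - ξ₂) * (w - ξ₃) :=
    ⟨(w - ξ₁) * (w - ξ₂) * (w - ξ₃) / V, by field_simp⟩
  have hqp : 0 < q := by
    rw [← hq] at hB
    exact pos_of_mul_pos_right hB hvp.le
  obtain rfl : w = ξ₁ + ξ₂ + ξ₃ - 1 := by linarith
  have hV' : V = (1 + (ξ₁ + ξ₂ + ξ₃ - 1) ^ 2 - ξ₁ ^ 2 - ξ₂ ^ 2 - ξ₃ ^ 2) / 2 := by linarith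
  have hq9 : q < 1 / 9 := by
    -- With `bᵢ = w - ξᵢ` and `e = 1 - w`, one has `V = ∏ ξᵢ + ∏ (1 - ξᵢ)`. Dropping `e > 0` bounds
    -- this strictly below by `∏ (bᵢ + bⱼ) + ∏ bᵢ`, which is at least `(8 + 1) ∏ bᵢ = 9 V q`.
    have h9 : V - 9 * (V * q) > 0 := by
      rw [hq, hV']
      obtain ⟨b₁, hb₁⟩ : ∃ b, b = ξ₂ + ξ₃ - 1 := ⟨_, rfl⟩
      obtain ⟨b₂, hb₂⟩ : ∃ b, b = ξ₁ + ξ₃ - 1 := ⟨_, rfl⟩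
      obtain ⟨b₃, hb₃⟩ : ∃ b, b = ξ₁ + ξ₂ - 1 := ⟨_, rfl⟩
      obtain ⟨e, he⟩ : ∃ e, e = 2 - ξ₁ - ξ₂ - ξ₃ := ⟨_, rfl⟩
      have p1 : 0 < b₁ := by linarith
      have p2 : 0 < b₂ := by linarith
      have p3 : 0 < b₃ := by linarith
      have pe : 0 < e := by linarith
      have h8 : 0 ≤ (b₁ + b₂) * (b₁ + b₃) * (b₂ + b₃) - 8 * (b₁ * b₂ * b₃) := by
        have : (b₁ + b₂) * (b₁ + b₃) * (b₂ + b₃) - 8 * (b₁ * b₂ * b₃) =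
          b₁ * (b₂ - b₃) ^ 2 + b₂ * (b₁ - b₃) ^ 2 + b₃ * (b₁ - b₂) ^ 2 := by ring
        rw [this]
        positivity
      have k1 : (b₁ + b₂) * (b₁ + b₃) * (b₂ + b₃) < ξ₁ * ξ₂ * ξ₃ := by
        obtain rfl : ξ₁ = b₂ + b₃ + e := by linarith
        obtain rfl : ξ₂ = b₁ + b₃ + e := by linarith
        obtain rfl : ξ₃ = b₁ + b₂ + e := by linarith
        rw [← sub_pos]
        have : (b₂ + b₃ + e) * (b₁ + b₃ + e) * (b₁ + b₂ + e)
            - (b₁ + b₂) * (b₁ + b₃) * (b₂ + b₃) =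
          e * ((b₂ + b₃ + e) * (b₁ + b₃ + e) + (b₂ + b₃ + e) * (b₁ + b₂)
            + (b₁ + b₃) * (b₁ + b₂)) := by ring
        rw [this]
        positivity
      have k2 : b₁ * b₂ * b₃ < (1 - ξ₁) * (1 - ξ₂) * (1 - ξ₃) := by
        rw [show 1 - ξ₁ = b₁ + e by linarith, show 1 - ξ₂ = b₂ + e by linarith,
          show 1 - ξ₃ = b₃ + e by linarith]
        gcongr <;> linarith
      rw [hb₁, hb₂, hb₃] at *
      nlinarith only [h8, k1, k2]
    nlinarith only [h9, hvp]
  -- For fixed `w` the value is largest at equal `ξᵢ`, so `V ≤ (1 - w + w²)/3`.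
  have hv3 : V < 1 / 3 := by
    rw [hV']
    nlinarith only [sq_nonneg (ξ₁ - ξ₂), sq_nonneg (ξ₁ - ξ₃), sq_nonneg (ξ₂ - ξ₃), hwp, hw]
  refine ⟨q, hqp, hq9, hv3, hwp, ?_, ?_, ?_, ?_⟩
  · have e : 1 + (ξ₁ + ξ₂ + ξ₃ - 1) ^ 3 - ξ₁ ^ 3 - ξ₂ ^ 3 - ξ₃ ^ 3 = 3 * (V + V * q) := by
      rw [hq, hV']
      ring
    rw [hh, zero_add, e]
    norm_num
    field_simp
    ring
  · have e : 1 + (ξ₁ + ξ₂ + ξ₃ - 1) ^ 4 - ξ₁ ^ 4 - ξ₂ ^ 4 - ξ₃ ^ 4 =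
        4 * (V + V * q * (ξ₁ + ξ₂ + ξ₃)) - 2 * V ^ 2 := by
      rw [hq, hV']
      ring
    rw [hh, show 1 + 3 = 4 from rfl, e]
    norm_num
    field_simp
    ring
  · have e : 1 + (ξ₁ + ξ₂ + ξ₃ - 1) ^ 5 - ξ₁ ^ 5 - ξ₂ ^ 5 - ξ₃ ^ 5 =
        5 * (V + V * q * (1 + (ξ₁ + ξ₂ + ξ₃ - 1) + (ξ₁ + ξ₂ + ξ₃ - 1) ^ 2))
          - 5 * V * (V + V * q) := by
      rw [hq, hV']
      ring
    rw [hh, show 2 + 3 = 5 from rfl, e]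
    norm_num
    field_simp
    ring
  · have e : 1 + (ξ₁ + ξ₂ + ξ₃ - 1) ^ 6 - ξ₁ ^ 6 - ξ₂ ^ 6 - ξ₃ ^ 6 =
        6 * (V + V * q * (1 + (ξ₁ + ξ₂ + ξ₃ - 1) + (ξ₁ + ξ₂ + ξ₃ - 1) ^ 2
            + (ξ₁ + ξ₂ + ξ₃ - 1) ^ 3))
          - 6 * V * (V + V * q * (ξ₁ + ξ₂ + ξ₃)) - 3 * (V + V * q) ^ 2 + 2 * V ^ 3 := by
      rw [hq, hV']
      ring
    rw [hh, show 3 + 3 = 6 from rfl, e]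
    norm_num
    field_simp
    ring

/-! ### The symmetric and non-symmetric cases. -/

/-- Symmetric semigroups are those whose numerator is `(1 - t^a)(1 - t^b)`. -/
theorem IsSymmetric.product {d : Fin 3 → ℕ} (hd : Admissible d) (hs : IsSymmetric d) :
    ∃ a b : ℕ, 0 < a ∧ 0 < b ∧
      hilbert d * ∏ i, (1 - (PowerSeries.X : PowerSeries ℤ) ^ d i) =
        ((1 - Polynomial.X ^ a - Polynomial.X ^ b + Polynomial.X ^ (a + b) :
          Polynomial ℤ) : PowerSeries ℤ) := by
  rcases numerator_cases hd with hp | ⟨x₁, x₂, x₃, y₁, y₂, h1, h2, h3, h4, h5, h6, hP⟩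
  · exact hp
  exfalso
  have h0 := (isSymmetric_iff hd).mp hs
  rcases le_total y₁ y₂ with hy | hy
  · obtain ⟨ξ₁, ξ₂, ξ₃, w, k1, k2, k3, k4, k5, k6, k7⟩ := h_of_six_terms hd h1 h2 h3 hy hP
    obtain ⟨q, hq, -, -, -, hh, -⟩ := h_of_six_terms_reduced hd k1 k2 k3 k4 k5 k6 k7
    linarith
  · rw [add_right_comm] at hP
    obtain ⟨ξ₁, ξ₂, ξ₃, w, k1, k2, k3, k4, k5, k6, k7⟩ := h_of_six_terms hd h4 h5 h6 hy hP
    obtain ⟨q, hq, -, -, -, hh, -⟩ := h_of_six_terms_reduced hd k1 k2 k3 k4 k5 k6 k7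
    linarith

theorem h_zero_of_product {d : Fin 3 → ℕ} {α : ℝ} (h0 : 0 < α) (h1 : α < 1)
    (hh : ∀ r : ℕ, h d r = (1 - α ^ (r + 3) - (1 - α) ^ (r + 3)) /
        ((r + 1) * (r + 2) * (r + 3) * (α * (1 - α)))) : h d 0 = 1 / 2 := by
  have : 0 < 1 - α := sub_pos.mpr h1
  rw [hh, div_eq_div_iff (by positivity) (by norm_num)]
  norm_num
  ring

theorem nonsymmetric_h {d : Fin 3 → ℕ} (hd : Admissible d) (hs : ¬ IsSymmetric d) :
    ∃ q w : ℝ, 0 < q ∧ q < 1 / 9 ∧ v d < 1 / 3 ∧ 0 < w ∧ w < 1 ∧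
      h d 0 = (1 + q) / 2 ∧
      h d 1 = (1 + q * (1 + w) - v d / 2) / 6 ∧
      h d 2 = (1 + q * (1 + w + w ^ 2) - v d * (1 + q)) / 12 ∧
      h d 3 = (1 + q * (1 + w + w ^ 2 + w ^ 3) - v d * (1 + q * (1 + w) + (1 + q) ^ 2 / 2)
        + v d ^ 2 / 3) / 20 := by
  rcases numerator_cases hd with ⟨a, b, ha, hb, hP⟩ |
    ⟨x₁, x₂, x₃, y₁, y₂, h1, h2, h3, h4, h5, h6, hP⟩
  · obtain ⟨-, α, h0, h1, -, hh⟩ := h_of_product hd ha hb hP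
    exact absurd ((isSymmetric_iff hd).mpr (h_zero_of_product h0 h1 hh)) hs
  rcases le_total y₁ y₂ with hy | hy
  · obtain ⟨ξ₁, ξ₂, ξ₃, w, k1, k2, k3, k4, k5, k6, k7⟩ := h_of_six_terms hd h1 h2 h3 hy hP
    obtain ⟨q, e1, e2, e3, e4, e5⟩ := h_of_six_terms_reduced hd k1 k2 k3 k4 k5 k6 k7
    exact ⟨q, w, e1, e2, e3, e4, k4, e5⟩
  · rw [add_right_comm] at hP
    obtain ⟨ξ₁, ξ₂, ξ₃, w, k1, k2, k3, k4, k5, k6, k7⟩ := h_of_six_terms hd h4 h5 h6 hy hP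
    obtain ⟨q, e1, e2, e3, e4, e5⟩ := h_of_six_terms_reduced hd k1 k2 k3 k4 k5 k6 k7
    exact ⟨q, w, e1, e2, e3, e4, k4, e5⟩

theorem nonsymmetric_bounds {d : Fin 3 → ℕ} (hd : Admissible d) (hs : ¬ IsSymmetric d) :
    h d 0 ∈ Set.Ico (1 / 2) (5 / 9) ∧ h d 1 ∈ Set.Ioo (5 / 36) (11 / 54) ∧
      h d 2 ∈ Set.Ioo (1 / 18) (1 / 9) ∧ h d 3 ∈ Set.Ioo 0.02443 0.07515 := by
  obtain ⟨q, w, hq, hq9, hv3, hw, hw1, e0, e1, e2, e3⟩ := nonsymmetric_h hd hs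
  have hv := v_pos hd
  rw [e0, e1, e2, e3]
  generalize v d = V at *
  -- Bounding every monomial makes the goals linear. The constants for `h₁` and `h₂` are the values
  -- at `q = 0`, `v = 1/3` and at `q = 1/9`, `w = 1`, `v = 0`; those for `h₃` leave some slack.
  have hw2 : w ^ 2 < 1 := pow_lt_one₀ hw.le hw1 two_ne_zero
  have hw3 : w ^ 3 < 1 := pow_lt_one₀ hw.le hw1 three_ne_zero
  have hqw : 0 < q * w := mul_pos hq hw
  have hqw2 : 0 < q * w ^ 2 := by positivity
  have hqw3 : 0 < q * w ^ 3 := by positivity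
  have hqw' : q * w < q := mul_lt_of_lt_one_right hq hw1
  have hqw2' : q * w ^ 2 < q := mul_lt_of_lt_one_right hq hw2
  have hqw3' : q * w ^ 3 < q := mul_lt_of_lt_one_right hq hw3
  have hvq : 0 < V * q := mul_pos hv hq
  have hvq' : V * q < q / 3 := by nlinarith only [hv3, hq]
  have hvqw : V * (q * w) < q * w / 3 := by nlinarith only [hv3, hqw]
  have hvqw' : 0 < V * (q * w) := by positivity
  have hvqq : V * q ^ 2 < q / 27 := by nlinarith only [hvq', hq9, hq]
  have hvqq' : 0 < V * q ^ 2 := by positivity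
  have hvv : V ^ 2 < V / 3 := by nlinarith only [hv3, hv]
  have hvv' : 0 < V ^ 2 := by positivity
  refine ⟨⟨?_, ?_⟩, ⟨?_, ?_⟩, ⟨?_, ?_⟩, ⟨?_, ?_⟩⟩ <;> norm_num <;> linarith

/-- The polynomial `1 - α^n - (1 - α)^n` is invariant under `α ↦ 1 - α` and vanishes at `0`, so for
`n ≥ 1` it is `v = α(1 - α)` times a polynomial in `v`. -/
theorem symmetric_h {d : Fin 3 → ℕ} (hd : Admissible d) (hs : IsSymmetric d) :
    v d ≤ 1 / 4 ∧
      h d 1 = 1 / 6 * (1 - 1 / 2 * v d) ∧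
      h d 2 = 1 / 12 * (1 - v d) ∧
      h d 3 = 1 / 20 * (1 - 3 / 2 * v d + 1 / 3 * v d ^ 2) ∧
      h d 4 = 1 / 30 * (1 - 2 * v d + v d ^ 2) ∧
      h d 5 = 1 / 42 * (1 - 5 / 2 * v d + 2 * v d ^ 2 - 1 / 4 * v d ^ 3) ∧
      h d 6 = 1 / 56 * (1 - 3 * v d + 10 / 3 * v d ^ 2 - v d ^ 3) := by
  obtain ⟨a, b, ha, hb, hP⟩ := hs.product hd
  obtain ⟨-, α, h0, h1, hv, hh⟩ := h_of_product hd ha hb hP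
  have h2 : 0 < 1 - α := sub_pos.mpr h1
  rw [hv]
  refine ⟨by nlinarith only [sq_nonneg (α - 1 / 2)], ?_, ?_, ?_, ?_, ?_, ?_⟩ <;>
  · rw [hh, div_eq_iff (by positivity)]
    push_cast
    ring

theorem symmetric_syzygy {d : Fin 3 → ℕ} (hd : Admissible d) (hs : IsSymmetric d) :
    (∃ x y, IsSyzygyDegrees d x y) ∧ ∀ x y, IsSyzygyDegrees d x y → u d y = 1 := by
  obtain ⟨a, b, ha, hb, hP⟩ := hs.product hd
  obtain ⟨hg, -⟩ := h_of_product hd ha hb hP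
  push_cast at hP
  constructor
  -- The product has four terms; the missing pair `x₃ = y` cancels and has degree `0`.
  · refine ⟨![a, b, 0], 0, ?_, ?_, by omega, fun _ _ => rfl⟩
    · rw [hP, hg, Fin.sum_univ_three]
      simp
      ring
    · intro j
      fin_cases j <;> simp <;> omega
  · intro x y hxy
    have hgp : (0 : ℝ) < g d := by exact_mod_cast g_pos hd
    have hy : y = 0 := by
      by_contra hy
      have hne : ∀ j, y ≠ x j := fun j hj => hy (hxy.cancel j hj.symm)
      -- For `0 < y < g₃` different from all `x j`, the coefficient at `y` is `1` on the syzygy side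
      -- and at most `0` on the product side.
      have h1 := congrArg (PowerSeries.coeff y) (hP.symm.trans hxy.rep)
      have hlt := hxy.y_lt
      simp only [map_add, map_sub, map_sum, PowerSeries.coeff_X_pow, PowerSeries.coeff_one,
        if_neg hy, if_neg (hne _), hg, if_neg hlt.ne, Finset.sum_const_zero, if_true] at h1
      split_ifs at h1 <;> norm_num at h1
    rw [u, hy]
    field_simp
    simp

/-! ### Symmetric examples with `v = 1/4` and with `v → 0`. -/

/-- A sufficient condition for a semigroup to be symmetric with a given Frobenius number. -/
theorem symmetric_of_frob {d : Fin 3 → ℕ} {F : ℕ} (hF : F ∈ gaps d)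
    (h : ∀ s ∈ gaps d, s ≤ F ∧ F - s ∈ semigroup d) : IsSymmetric d ∧ frob d = F := by
  have hf : frob d = F := IsGreatest.csSup_eq ⟨hF, fun s hs => (h s hs).1⟩
  exact ⟨fun s hs => by rw [hf]; exact fun h' => h' (h s hs).2, hf⟩

/-- Minimality of a generator is proved by a submonoid `M` that contains the other two and omits it.
-/
theorem notMem_closure_of_le {A : Set ℕ} {n : ℕ} (M : AddSubmonoid ℕ) (hA : A ⊆ M)
    (hn : n ∉ M) : n ∉ AddSubmonoid.closure A :=
  fun h => hn ((AddSubmonoid.closure_le.mpr hA) h)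

theorem image_compl_subset {d : Fin 3 → ℕ} {i : Fin 3} {M : Set ℕ}
    (h : ∀ j, j ≠ i → d j ∈ M) : d '' {i}ᶜ ⊆ M := by
  rintro _ ⟨j, hj, rfl⟩
  exact h j hj

theorem admissible_six : Admissible ![6, 10, 15] where
  gcd_eq_one := by decide
  three_le := by decide
  lt01 := by decide
  lt12 := by decide
  le_bound := by decide
  minimal := by
    have key : ∀ (i : Fin 3) (m : ℕ), (∀ j, j ≠ i → m ∣ (![6, 10, 15] : Fin 3 → ℕ) j) →
        ¬ m ∣ (![6, 10, 15] : Fin 3 → ℕ) i → (![6, 10, 15] : Fin 3 → ℕ) i ∉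
          AddSubmonoid.closure ((![6, 10, 15] : Fin 3 → ℕ) '' {i}ᶜ) := by
      intro i m h1 h2
      refine notMem_closure_of_le (AddSubmonoid.multiples m)
        (image_compl_subset fun j hj => ?_) fun h => h2 ?_
      · obtain ⟨c, hc⟩ := h1 j hj
        exact ⟨c, by simp [hc, mul_comm]⟩
      · obtain ⟨c, hc⟩ := h
        exact ⟨c, by simpa [mul_comm] using hc.symm⟩
    intro i
    fin_cases i
    · exact key 0 5 (by decide) (by decide)
    · exact key 1 3 (by decide) (by decide)
    · exact key 2 2 (by decide) (by decide)

theorem symmetric_six : IsSymmetric ![6, 10, 15] ∧ v ![6, 10, 15] = 1 / 4 := by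
  have hmem : ∀ n, n ∈ semigroup ![6, 10, 15] ↔ ∃ a b c, a * 6 + b * 10 + c * 15 = n := fun n =>
    mem_semigroup_iff
  have hs := symmetric_of_frob (d := ![6, 10, 15]) (F := 29)
    (by
      change 29 ∉ _
      rw [hmem]
      rintro ⟨a, b, c, h⟩
      omega)
    (by
      intro s hs
      change s ∉ _ at hs
      rw [hmem] at hs
      have h1 : s ≤ 29 := by
        by_contra h1
        apply hs
        -- The coefficient of `15` is read off modulo `2`, then that of `10` modulo `3`; the rest is
        -- a nonnegative multiple of `6` once `s ≥ 30`.
        refine ⟨((s - 15 * (s % 2)) / 2 - 5 * ((s - 15 * (s % 2)) % 3)) / 3,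
          (s - 15 * (s % 2)) % 3, s % 2, ?_⟩
        omega
      refine ⟨h1, ?_⟩
      rw [hmem]
      have key : ∀ s ≤ 29, (∃ a < 5, ∃ b < 3, ∃ c < 2, a * 6 + b * 10 + c * 15 = s) ∨
          ∃ a < 5, ∃ b < 3, ∃ c < 2, a * 6 + b * 10 + c * 15 = 29 - s := by decide
      rcases key s h1 with ⟨a, -, b, -, c, -, h⟩ | ⟨a, -, b, -, c, -, h⟩
      · exact absurd ⟨a, b, c, h⟩ hs
      · exact ⟨a, b, c, h⟩)
  refine ⟨hs.1, ?_⟩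
  rw [v, g, hs.2, prodGen, Fin.sum_univ_three, Fin.prod_univ_three]
  simp only [Matrix.cons_val]
  norm_num

/-- The generators `2k, 2k + 1, 2k + 2` with `k = n + 2`. -/
def consecutive (n : ℕ) : Fin 3 → ℕ := ![2 * n + 4, 2 * n + 5, 2 * n + 6]

theorem admissible_consecutive (n : ℕ) : Admissible (consecutive n) where
  gcd_eq_one := by
    have h : Nat.gcd (2 * n + 4) (2 * n + 5) = 1 := by
      rw [show 2 * n + 5 = 2 * n + 4 + 1 by ring]
      simp
    simp [consecutive, h]
  three_le := by simp [consecutive]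
  lt01 := by simp [consecutive]
  lt12 := by simp [consecutive]
  le_bound := by
    simp only [consecutive, Matrix.cons_val]
    nlinarith
  minimal := by
    intro i
    fin_cases i
    · refine notMem_closure_of_le
        { carrier := {m | m = 0 ∨ 2 * n + 5 ≤ m}
          add_mem' := by
            intro a b ha hb
            simp only [Set.mem_ofPred_eq] at *
            omega
          zero_mem' := Or.inl rfl } (image_compl_subset fun j hj => ?_) ?_
      · fin_cases j
        · exact absurd rfl hj
        · exact Or.inr (by simp [consecutive])
        · exact Or.inr (by simp [consecutive])
      · change ¬ (consecutive n 0 = 0 ∨ 2 * n + 5 ≤ consecutive n 0)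
        simp [consecutive]
    · refine notMem_closure_of_le
        { carrier := {m | m % 2 = 0}
          add_mem' := by
            intro a b ha hb
            simp only [Set.mem_ofPred_eq] at *
            omega
          zero_mem' := rfl } (image_compl_subset fun j hj => ?_) ?_
      · fin_cases j
        · change (2 * n + 4) % 2 = 0
          omega
        · exact absurd rfl hj
        · change (2 * n + 6) % 2 = 0
          omega
      · change ¬ (2 * n + 5) % 2 = 0
        omega
    · refine notMem_closure_of_le
        { carrier := {m | m = 0 ∨ m = 2 * n + 4 ∨ m = 2 * n + 5 ∨ 4 * n + 8 ≤ m}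
          add_mem' := by
            intro a b ha hb
            simp only [Set.mem_ofPred_eq] at *
            omega
          zero_mem' := Or.inl rfl } (image_compl_subset fun j hj => ?_) ?_
      · fin_cases j
        · exact Or.inr (Or.inl rfl)
        · exact Or.inr (Or.inr (Or.inl rfl))
        · exact absurd rfl hj
      · change ¬ (2 * n + 6 = 0 ∨ 2 * n + 6 = 2 * n + 4 ∨ 2 * n + 6 = 2 * n + 5 ∨
          4 * n + 8 ≤ 2 * n + 6)
        omega

/-- Sums of `j` generators fill the interval from `2k j` to `2k j + 2j`, where `k = n + 2`. -/
theorem mem_semigroup_consecutive {n m : ℕ} : m ∈ semigroup (consecutive n) ↔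
    ∃ j i, i ≤ 2 * j ∧ m = (2 * n + 4) * j + i := by
  rw [mem_semigroup_iff]
  change (∃ a b c, a * (2 * n + 4) + b * (2 * n + 5) + c * (2 * n + 6) = m) ↔ _
  constructor
  · rintro ⟨a, b, c, rfl⟩
    exact ⟨a + b + c, b + 2 * c, by omega, by ring⟩
  · rintro ⟨j, i, hi, rfl⟩
    rcases le_total i j with h | h
    · obtain ⟨e, rfl⟩ := Nat.exists_eq_add_of_le h
      exact ⟨e, i, 0, by ring⟩
    · obtain ⟨e, rfl⟩ := Nat.exists_eq_add_of_le h
      obtain ⟨f, rfl⟩ := Nat.exists_eq_add_of_le (by omega : e ≤ j)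
      exact ⟨0, f, e, by ring⟩

/-- Write `s = 2k j + i` with `i < 2k`. Gaps have `i > 2j`, and `s ↦ F - s` with `F = 2k² - 1` is
the reflection `(j, i) ↦ (k - 1 - j, 2k - 1 - i)`, which carries `i > 2j` to the opposite condition.
-/
theorem symmetric_consecutive (n : ℕ) :
    IsSymmetric (consecutive n) ∧ frob (consecutive n) = 2 * n ^ 2 + 8 * n + 7 := by
  apply symmetric_of_frob
  · change _ ∉ _
    rw [mem_semigroup_consecutive]
    rintro ⟨j, i, hi, h⟩
    rcases lt_or_ge j (n + 2) with hj | hj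
    · have : j ≤ n + 1 := by omega
      nlinarith
    · nlinarith
  · intro s hs
    change s ∉ _ at hs
    rw [mem_semigroup_consecutive] at hs ⊢
    have hdiv := Nat.div_add_mod s (2 * n + 4)
    have hlt := Nat.mod_lt s (by omega : 2 * n + 4 > 0)
    generalize s / (2 * n + 4) = j at *
    generalize s % (2 * n + 4) = i at *
    have hi : 2 * j < i := by
      by_contra hc
      exact hs ⟨j, i, not_lt.mp hc, hdiv.symm⟩
    obtain ⟨e, he⟩ := Nat.exists_eq_add_of_le (by omega : j ≤ n + 1)
    obtain ⟨f, hf⟩ := Nat.exists_eq_add_of_le (by omega : i ≤ 2 * n + 3)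
    have hF : 2 * n ^ 2 + 8 * n + 7 = ((2 * n + 4) * e + f) + s := by
      rw [← hdiv]
      have : 2 * n ^ 2 + 8 * n + 7 = (2 * n + 4) * (n + 1) + (2 * n + 3) := by ring
      rw [this, he, hf]
      ring
    refine ⟨by omega, e, f, by omega, by omega⟩

open Filter Topology in
theorem tendsto_v_consecutive : Tendsto (fun n => v (consecutive n)) atTop (𝓝 0) := by
  have hb : Tendsto (fun n : ℕ => 12 * (1 / ((n : ℝ) + 1))) atTop (𝓝 0) := by
    simpa using tendsto_one_div_add_atTop_nhds_zero_nat.const_mul (12 : ℝ)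
  refine squeeze_zero (fun n => (v_pos (admissible_consecutive n)).le) (fun n => ?_) hb
  have hg : (g (consecutive n) : ℝ) = 2 * n ^ 2 + 14 * n + 22 := by
    rw [g, (symmetric_consecutive n).2, Fin.sum_univ_three]
    simp [consecutive]
    ring
  have hp : (prodGen (consecutive n) : ℝ) = (2 * n + 4) * (2 * n + 5) * (2 * n + 6) := by
    rw [prodGen, Fin.prod_univ_three]
    simp [consecutive]
  rw [v, hg, hp, mul_one_div, div_le_div_iff₀ (by positivity) (by positivity)]
  have hn : (0 : ℝ) ≤ n := n.cast_nonneg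
  rw [← sub_nonneg]
  ring_nf
  positivity

/-! ### Sharpness and the bounds for symmetric semigroups. -/

open Filter Topology in
/-- If `h r` is a decreasing function `f` of `v` on symmetric semigroups, its infimum is attained
at `v = 1 / 4` and its supremum is the value at `v = 0`. -/
theorem isLeast_isLUB_symValues {r : ℕ} {f : ℝ → ℝ} {lo hi : ℝ} (hf : Continuous f)
    (hr : ∀ d, Admissible d → IsSymmetric d → h d r = f (v d))
    (hlo : f (1 / 4) = lo) (hhi : f 0 = hi)
    (hI : ∀ d, Admissible d → IsSymmetric d → h d r ∈ Set.Ico lo hi) :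
    IsLeast (symValues r) lo ∧ IsLUB (symValues r) hi := by
  refine ⟨⟨⟨_, admissible_six, symmetric_six.1, ?_⟩, ?_⟩, ?_, ?_⟩
  · rw [hr _ admissible_six symmetric_six.1, symmetric_six.2, hlo]
  · rintro _ ⟨d, hd, hs, rfl⟩
    exact (hI d hd hs).1
  · rintro _ ⟨d, hd, hs, rfl⟩
    exact (hI d hd hs).2.le
  · intro B hB
    have ht : Tendsto (fun n => f (v (consecutive n))) atTop (𝓝 hi) :=
      hhi ▸ (hf.tendsto 0).comp tendsto_v_consecutive
    refine le_of_tendsto' ht fun n => ?_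
    rw [← hr _ (admissible_consecutive n) (symmetric_consecutive n).1]
    exact hB ⟨_, admissible_consecutive n, (symmetric_consecutive n).1, rfl⟩

theorem symmetric_bounds {d : Fin 3 → ℕ} (hd : Admissible d) (hs : IsSymmetric d) :
    (h d 1 ∈ Set.Ico (7 / 48) (1 / 6) ∧
      h d 2 ∈ Set.Ico (1 / 16) (1 / 12) ∧
      h d 3 ∈ Set.Ico (31 / 960) (1 / 20) ∧
      h d 4 ∈ Set.Ico (3 / 160) (1 / 30) ∧
      h d 5 ∈ Set.Ico (127 / 10752) (1 / 42) ∧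
      h d 6 ∈ Set.Ico (85 / 10752) (1 / 56)) ∧
    (v d < 1 / 4 →
      h d 1 ∈ Set.Ioo (7 / 48) (1 / 6) ∧
      h d 2 ∈ Set.Ioo (1 / 16) (1 / 12) ∧
      h d 3 ∈ Set.Ioo (31 / 960) (1 / 20) ∧
      h d 4 ∈ Set.Ioo (3 / 160) (1 / 30) ∧
      h d 5 ∈ Set.Ioo (127 / 10752) (1 / 42) ∧
      h d 6 ∈ Set.Ioo (85 / 10752) (1 / 56)) := by
  obtain ⟨hv4, e1, e2, e3, e4, e5, e6⟩ := symmetric_h hd hs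
  have hv := v_pos hd
  rw [e1, e2, e3, e4, e5, e6]
  generalize v d = V at *
  -- The lower bounds are the values at `t = 0`. Bounding `t²` by `t / 4` and `t³` by `t² / 4` makes
  -- every goal linear, and `t < 1/4` keeps the upper bounds strict.
  obtain ⟨t, rfl⟩ : ∃ t, V = 1 / 4 - t := ⟨1 / 4 - V, by ring⟩
  have ht4 : t < 1 / 4 := by linarith
  have ht : 0 ≤ t := by linarith
  have ht2 : 0 ≤ t ^ 2 := by positivity
  have ht2' : t ^ 2 ≤ t / 4 := by nlinarith only [ht, ht4]
  have ht3 : 0 ≤ t ^ 3 := by positivity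
  have ht3' : t ^ 3 ≤ t ^ 2 / 4 := by nlinarith only [ht2, ht4]
  constructor
  · refine ⟨⟨?_, ?_⟩, ⟨?_, ?_⟩, ⟨?_, ?_⟩, ⟨?_, ?_⟩, ⟨?_, ?_⟩, ⟨?_, ?_⟩⟩ <;>
      ring_nf <;> linarith
  · intro h
    have ht0 : 0 < t := by linarith
    refine ⟨⟨?_, ?_⟩, ⟨?_, ?_⟩, ⟨?_, ?_⟩, ⟨?_, ?_⟩, ⟨?_, ?_⟩, ⟨?_, ?_⟩⟩ <;>
      ring_nf <;> linarith

end NS3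

theorem mainTheorem6 :
    -- every symmetric semigroup
    (∀ d : Fin 3 → ℕ, Admissible d → IsSymmetric d →
      h d 0 = 1 / 2 ∧
      ((∃ x y, IsSyzygyDegrees d x y) ∧ ∀ x y, IsSyzygyDegrees d x y → u d y = 1) ∧
      (0 < v d ∧ v d ≤ 1 / 4) ∧
      h d 1 = 1 / 6 * (1 - 1 / 2 * v d) ∧
      h d 2 = 1 / 12 * (1 - v d) ∧
      h d 3 = 1 / 20 * (1 - 3 / 2 * v d + 1 / 3 * v d ^ 2) ∧
      h d 4 = 1 / 30 * (1 - 2 * v d + v d ^ 2) ∧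
      h d 5 = 1 / 42 * (1 - 5 / 2 * v d + 2 * v d ^ 2 - 1 / 4 * v d ^ 3) ∧
      h d 6 = 1 / 56 * (1 - 3 * v d + 10 / 3 * v d ^ 2 - v d ^ 3) ∧
      (h d 1 ∈ Set.Ico (7 / 48) (1 / 6) ∧
        h d 2 ∈ Set.Ico (1 / 16) (1 / 12) ∧
        h d 3 ∈ Set.Ico (31 / 960) (1 / 20) ∧
        h d 4 ∈ Set.Ico (3 / 160) (1 / 30) ∧
        h d 5 ∈ Set.Ico (127 / 10752) (1 / 42) ∧
        h d 6 ∈ Set.Ico (85 / 10752) (1 / 56)) ∧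
      (v d < 1 / 4 →
        h d 1 ∈ Set.Ioo (7 / 48) (1 / 6) ∧
        h d 2 ∈ Set.Ioo (1 / 16) (1 / 12) ∧
        h d 3 ∈ Set.Ioo (31 / 960) (1 / 20) ∧
        h d 4 ∈ Set.Ioo (3 / 160) (1 / 30) ∧
        h d 5 ∈ Set.Ioo (127 / 10752) (1 / 42) ∧
        h d 6 ∈ Set.Ioo (85 / 10752) (1 / 56))) ∧
    -- these intervals are sharp
    ((IsLeast (symValues 1) (7 / 48) ∧ IsLUB (symValues 1) (1 / 6)) ∧
      (IsLeast (symValues 2) (1 / 16) ∧ IsLUB (symValues 2) (1 / 12)) ∧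
      (IsLeast (symValues 3) (31 / 960) ∧ IsLUB (symValues 3) (1 / 20)) ∧
      (IsLeast (symValues 4) (3 / 160) ∧ IsLUB (symValues 4) (1 / 30)) ∧
      (IsLeast (symValues 5) (127 / 10752) ∧ IsLUB (symValues 5) (1 / 42)) ∧
      (IsLeast (symValues 6) (85 / 10752) ∧ IsLUB (symValues 6) (1 / 56))) ∧
    -- the ranges of the non-symmetric semigroups
    (nonsymValues 0 ⊆ Set.Ico (1 / 2) (5 / 9) ∧
      nonsymValues 1 ⊆ Set.Ioo (5 / 36) (11 / 54) ∧
      nonsymValues 2 ⊆ Set.Ioo (1 / 18) (1 / 9) ∧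
      nonsymValues 3 ⊆ Set.Ioo 0.02443 0.07515) ∧
    -- they contain the symmetric intervals, for `r = 1, 2, 3` in their interior
    ((symValues 0 = {1 / 2} ∧ (1 / 2 : ℝ) ∈ Set.Ico (1 / 2 : ℝ) (5 / 9)) ∧
      Set.Icc (7 / 48 : ℝ) (1 / 6) ⊆ Set.Ioo (5 / 36) (11 / 54) ∧
      Set.Icc (1 / 16 : ℝ) (1 / 12) ⊆ Set.Ioo (1 / 18) (1 / 9) ∧
      Set.Icc (31 / 960 : ℝ) (1 / 20) ⊆ Set.Ioo 0.02443 0.07515) := by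
  have hI := fun d hd hs => (symmetric_bounds (d := d) hd hs).1
  have hh := fun d hd hs => (symmetric_h (d := d) hd hs).2
  refine ⟨fun d hd hs => ?_, ⟨?_, ?_, ?_, ?_, ?_, ?_⟩, ⟨?_, ?_, ?_, ?_⟩, ⟨?_, ?_⟩, ?_, ?_, ?_⟩
  · obtain ⟨e0, e1, e2, e3, e4, e5, e6⟩ := symmetric_h hd hs
    obtain ⟨b1, b2⟩ := symmetric_bounds hd hs
    exact ⟨(isSymmetric_iff hd).mp hs, symmetric_syzygy hd hs, ⟨v_pos hd, e0⟩,
      e1, e2, e3, e4, e5, e6, b1, b2⟩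
  · exact isLeast_isLUB_symValues (f := fun t => 1 / 6 * (1 - 1 / 2 * t)) (by fun_prop)
      (fun d hd hs => (hh d hd hs).1) (by norm_num) (by norm_num)
      fun d hd hs => (hI d hd hs).1
  · exact isLeast_isLUB_symValues (f := fun t => 1 / 12 * (1 - t)) (by fun_prop)
      (fun d hd hs => (hh d hd hs).2.1) (by norm_num) (by norm_num)
      fun d hd hs => (hI d hd hs).2.1
  · exact isLeast_isLUB_symValues (f := fun t => 1 / 20 * (1 - 3 / 2 * t + 1 / 3 * t ^ 2))
      (by fun_prop) (fun d hd hs => (hh d hd hs).2.2.1) (by norm_num) (by norm_num)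
      fun d hd hs => (hI d hd hs).2.2.1
  · exact isLeast_isLUB_symValues (f := fun t => 1 / 30 * (1 - 2 * t + t ^ 2))
      (by fun_prop) (fun d hd hs => (hh d hd hs).2.2.2.1) (by norm_num) (by norm_num)
      fun d hd hs => (hI d hd hs).2.2.2.1
  · exact isLeast_isLUB_symValues
      (f := fun t => 1 / 42 * (1 - 5 / 2 * t + 2 * t ^ 2 - 1 / 4 * t ^ 3))
      (by fun_prop) (fun d hd hs => (hh d hd hs).2.2.2.2.1) (by norm_num) (by norm_num)
      fun d hd hs => (hI d hd hs).2.2.2.2.1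
  · exact isLeast_isLUB_symValues
      (f := fun t => 1 / 56 * (1 - 3 * t + 10 / 3 * t ^ 2 - t ^ 3))
      (by fun_prop) (fun d hd hs => (hh d hd hs).2.2.2.2.2) (by norm_num) (by norm_num)
      fun d hd hs => (hI d hd hs).2.2.2.2.2
  · rintro _ ⟨d, hd, hs, rfl⟩
    exact (nonsymmetric_bounds hd hs).1
  · rintro _ ⟨d, hd, hs, rfl⟩
    exact (nonsymmetric_bounds hd hs).2.1
  · rintro _ ⟨d, hd, hs, rfl⟩
    exact (nonsymmetric_bounds hd hs).2.2.1
  · rintro _ ⟨d, hd, hs, rfl⟩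
    exact (nonsymmetric_bounds hd hs).2.2.2
  · ext t
    constructor
    · rintro ⟨d, hd, hs, rfl⟩
      exact (isSymmetric_iff hd).mp hs
    · rintro rfl
      exact ⟨_, admissible_six, symmetric_six.1,
        (isSymmetric_iff admissible_six).mp symmetric_six.1⟩
  · norm_num
  · exact Set.Icc_subset_Ioo (by norm_num) (by norm_num)
  · exact Set.Icc_subset_Ioo (by norm_num) (by norm_num)
  · exact Set.Icc_subset_Ioo (by norm_num) (by norm_num)
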